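/- Let $a,b,c\in\mathbb C$ with $c\notin\{0,-1,-2,\dots\}$. Let $F(a,b,c;w)$ denote the Gauss hypergeometric function, i.e. the sum of $\sum_{n\ge 0}\frac{(a)_n(b)_n}{(c)_n\,n!}w^n$ for $|w|<1$, continued analytically to $\mathbb C\setminus[1,\infty)$. Put $$d_{2j+1}=\frac{(a+j)(c-b+j)}{(c+2j)(c+2j+1)}\ (j\ge 0),\qquad d_{2j}=\frac{(b+j)(c-a+j)}{(c+2j-1)(c+2j)}\ (j\ge 1),$$ $$a_0=2-4d_2,\qquad a_n=2-4d_{2n+1}-4d_{2n+2}\ (n\ge 1),$$ $$b_k^2=16\,d_{2k+2}d_{2k+3}=16\,\frac{(a+k+1)(c-b+k+1)(b+k+1)(c-a+k+1)}{(c+2k+2)^2(c+2k+3)(c+2k+1)}\ (k\ge 0),$$ where $b_k$ is an arbitrary square root for finitely many $k$ and the principal square root for all sufficiently large $k$. Then: 1. The tridiagonal complex Jacobi matrix $J$ with diagonal entries $a_0,a_1,\dots$ and off-diagonal entries $b_0,b_1,\dots$ (both above and below the diagonal) generates a bounded linear operator on $\ell_2$, also denoted by $J$. 2. Assume in addition that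 $a\ne 0$ and $c\neq b$ (equivalently $d_1\ne 0$), and let $$B(a,b,c;z)=-\frac{1}{4d_1}\left(\frac{F\left(a,b,c;-\frac{4}{z-2}\right)}{F\left(a,b+1,c+1;-\frac{4}{z-2}\right)}-1\right).$$ For every $z$ in the resolvent set $\rho(J)$ one has $z\notin[-2,2]$ and $F\left(a,b+1,c+1;-\frac4{z-2}\right)\neq 0$, so that $B(a,b,c;z)$ is well defined, and $$B(a,b,c;z)=\left\langle (J-zI)^{-1}e,e\right\rangle_{\ell_2},\qquad e=(1,0,0,\dots)^{\top}.$$ 3. $J-J_0$ is trace class, where $J_0$ is the free Jacobi matrix, with zero diagonal and all off-diagonal entries equal to $1$. -/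

import Mathlib

namespace HypJacobi

section Hypergeometric

open Complex Set MeasureTheory
open scoped Interval

/-- The cut plane `ℂ \ [1, ∞)`. -/
def slitDomain : Set ℂ := (Complex.ofReal '' Set.Ici (1 : ℝ))ᶜ

/-- `f` is analytic on `ℂ \ [1, ∞)` and is given on the open unit disc by the Gauss series
`∑ (a)ₙ (b)ₙ / ((c)ₙ n!) wⁿ`. -/
structure IsGaussContinuation (a b c : ℂ) (f : ℂ → ℂ) : Prop where
  analytic : AnalyticOnNhd ℂ f slitDomain
  hasSum : ∀ w : ℂ, ‖w‖ < 1 →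
    HasSum (fun n : ℕ => (ascPochhammer ℂ n).eval a * (ascPochhammer ℂ n).eval b /
      ((ascPochhammer ℂ n).eval c * (n.factorial : ℂ)) * w ^ n) (f w)

/-- The Gauss hypergeometric function `F(a, b, c; w)`, that is, the sum of the Gauss series for
`|w| < 1` and its analytic continuation to `ℂ \ [1, ∞)`. For `c` not a nonpositive integer it
exists (`isGaussContinuation_hypF`) and is unique (`IsGaussContinuation.eqOn`) on that domain; its
values on the cut `[1, ∞)` carry no meaning. -/
noncomputable def hypF (a b c : ℂ) : ℂ → ℂ :=
  Classical.epsilon (IsGaussContinuation a b c)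

theorem isOpen_slitDomain : IsOpen slitDomain :=
  (Complex.isometry_ofReal.isClosedEmbedding.isClosedMap _ isClosed_Ici).isOpen_compl

theorem one_sub_mul_mem_slitPlane {x : ℂ} (hx : x ∈ slitDomain) {t : ℝ} (ht : t ∈ Icc (0:ℝ) 1) :
    1 - x * t ∈ slitPlane := by
  have h1 : 1 - x ∈ slitPlane := by
    rw [mem_slitPlane_iff]
    by_contra! h
    apply hx
    refine ⟨x.re, ?_, ?_⟩
    · simpa using h.1
    · apply Complex.ext <;> simp
      simpa [eq_comm] using h.2
  have := starConvex_one_slitPlane h1 (a := 1 - t) (b := t) (by linarith [ht.2]) ht.1 (by ring)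
  convert this using 1
  simp
  ring

theorem exists_continuation_of_re_pos (a b c : ℂ) (hb : 0 < b.re) (hcb : 0 < (c - b).re) :
    ∃ f, IsGaussContinuation a b c f := by
  set φ : ℝ → ℂ := fun t => (t : ℂ) ^ (b - 1) * (1 - (t : ℂ)) ^ (c - b - 1) with hφ
  have hφi : IntervalIntegrable φ volume 0 1 := betaIntegral_convergent hb hcb
  have hI : Ι (0:ℝ) 1 ⊆ Icc 0 1 := by
    rw [uIoc_of_le zero_le_one]; exact Ioc_subset_Icc_self
  have hφm : AEStronglyMeasurable φ (volume.restrict (Ι (0:ℝ) 1)) :=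
    (intervalIntegrable_iff.1 hφi).aestronglyMeasurable
  have hcont : ∀ (e : ℂ) x, x ∈ slitDomain →
      ContinuousOn (fun t : ℝ => (1 - x * (t : ℂ)) ^ e) (Icc 0 1) := by
    intro e x hx t ht
    apply ContinuousAt.continuousWithinAt
    exact ContinuousAt.cpow (by fun_prop) (by fun_prop) (one_sub_mul_mem_slitPlane hx ht)
  set f : ℂ → ℂ := fun w => ∫ t in (0:ℝ)..1, φ t * (1 - w * t) ^ (-a) with hf
  have hdiff : ∀ x ∈ slitDomain, DifferentiableAt ℂ f x := by
    intro x hx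
    obtain ⟨ε, hε, hball⟩ := Metric.nhds_basis_closedBall.mem_iff.1
      (isOpen_slitDomain.mem_nhds hx)
    have hK : IsCompact (Metric.closedBall x ε ×ˢ Icc (0:ℝ) 1) :=
      (isCompact_closedBall x ε).prod isCompact_Icc
    obtain ⟨M, hM⟩ := hK.exists_bound_of_continuousOn
      (f := fun p : ℂ × ℝ => (-a) * (1 - p.1 * (p.2 : ℂ)) ^ (-a - 1) * (-(p.2 : ℂ))) (by
        rintro ⟨y, t⟩ ⟨hy, ht⟩
        apply ContinuousAt.continuousWithinAt
        refine ContinuousAt.mul (ContinuousAt.mul continuousAt_const ?_) (by fun_prop)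
        exact ContinuousAt.cpow (by fun_prop) (by fun_prop) (one_sub_mul_mem_slitPlane (hball hy) ht))
    have key := intervalIntegral.hasDerivAt_integral_of_dominated_loc_of_deriv_le
      (μ := volume) (a := (0:ℝ)) (b := 1)
      (F := fun (w : ℂ) (t : ℝ) => φ t * (1 - w * t) ^ (-a))
      (F' := fun (w : ℂ) (t : ℝ) => φ t * ((-a) * (1 - w * t) ^ (-a - 1) * (-(t:ℂ))))
      (x₀ := x) (bound := fun t => ‖φ t‖ * M) (Metric.closedBall_mem_nhds x hε)
      ?_ ?_ ?_ ?_ ?_ ?_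
    · exact key.2.differentiableAt
    · filter_upwards [isOpen_slitDomain.mem_nhds hx] with y hy
      exact hφm.mul (((hcont _ y hy).mono hI).aestronglyMeasurable measurableSet_uIoc)
    · apply hφi.mul_continuousOn
      rw [uIcc_of_le zero_le_one]
      exact hcont _ x hx
    · refine hφm.mul (ContinuousOn.aestronglyMeasurable ?_ measurableSet_uIoc)
      refine ContinuousOn.mul (ContinuousOn.mul continuousOn_const ((hcont _ x hx).mono hI)) ?_
      fun_prop
    · filter_upwards with t ht y hy
      rw [norm_mul]
      exact mul_le_mul_of_nonneg_left (hM (y, t) ⟨hy, hI ht⟩) (norm_nonneg _)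
    · exact hφi.norm.mul_const M
    · filter_upwards with t ht y hy
      apply HasDerivAt.const_mul
      have h1 : HasDerivAt (fun w : ℂ => 1 - w * t) (-(t:ℂ)) y := by
        simpa using ((hasDerivAt_id y).mul_const (t:ℂ)).const_sub 1
      exact h1.cpow_const (one_sub_mul_mem_slitPlane (hball hy) (hI ht))
  have hsum : ∀ w : ℂ, ‖w‖ < 1 → HasSum (fun n : ℕ => (ascPochhammer ℂ n).eval a /
      (n.factorial : ℂ) * w ^ n * betaIntegral (b + n) (c - b)) (f w) := by
    intro w hw
    have hps := one_div_one_sub_cpow_hasFPowerSeriesOnBall_zero a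
    have hch : ∀ n : ℕ, Ring.choose (a + n - 1) n =
        (ascPochhammer ℂ n).eval a / (n.factorial : ℂ) := by
      intro n
      rw [← Ring.multichoose_eq, eq_div_iff (by exact_mod_cast n.factorial_ne_zero)]
      have := Ring.factorial_nsmul_multichoose_eq_ascPochhammer a n
      rw [Polynomial.ascPochhammer_smeval_cast, Polynomial.ascPochhammer_smeval_eq_eval] at this
      rw [← this, nsmul_eq_mul, mul_comm]
    have hs : ∀ v : ℂ, ‖v‖ < 1 → HasSum (fun n : ℕ => (ascPochhammer ℂ n).eval a /
        (n.factorial : ℂ) * v ^ n) ((1 - v) ^ (-a)) := by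
      intro v hv
      have := hps.hasSum (y := v) (by
        rw [Metric.mem_eball, edist_zero_right, ← ofReal_norm]
        rw [ENNReal.ofReal_lt_one]
        exact hv)
      simpa [hch, cpow_neg, mul_comm] using this
    have hsn : Summable fun n : ℕ => ‖(ascPochhammer ℂ n).eval a /
        (n.factorial : ℂ)‖ * ‖w‖ ^ n := by
      simpa using (hs w hw).summable.norm
    have key := intervalIntegral.hasSum_integral_of_dominated_convergence
      (μ := volume) (a := (0:ℝ)) (b := 1)
      (F := fun (n : ℕ) (t : ℝ) => φ t * ((ascPochhammer ℂ n).eval a /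
        (n.factorial : ℂ) * (w * t) ^ n)) (f := fun t => φ t * (1 - w * t) ^ (-a))
      (fun n t => ‖φ t‖ * (‖(ascPochhammer ℂ n).eval a /
        (n.factorial : ℂ)‖ * ‖w‖ ^ n)) ?_ ?_ ?_ ?_ ?_
    · refine (congrArg (fun F => HasSum F (f w)) (funext fun n => ?_)).mp key
      symm
      rw [betaIntegral, ← intervalIntegral.integral_const_mul]
      apply intervalIntegral.integral_congr_ae
      filter_upwards with t ht
      have ht0 : (t : ℂ) ≠ 0 := by
        rw [uIoc_of_le zero_le_one] at ht
        exact_mod_cast ht.1.ne'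
      have : (t:ℂ) ^ (b + n - 1) = (t:ℂ) ^ (b - 1) * (t:ℂ) ^ n := by
        rw [← cpow_natCast, ← cpow_add _ _ ht0]; congr 1; ring
      rw [this, hφ]
      ring
    · intro n
      refine hφm.mul (Continuous.aestronglyMeasurable ?_)
      fun_prop
    · intro n
      filter_upwards with t ht
      have ht' := hI ht
      rw [norm_mul (φ t), norm_mul (_ / _), norm_pow, norm_mul w, norm_real, Real.norm_of_nonneg ht'.1]
      have h0 := ht'.1
      have h1 := mul_le_of_le_one_right (norm_nonneg w) ht'.2
      gcongr
    · filter_upwards with t ht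
      exact hsn.mul_left _
    · simp_rw [tsum_mul_left]
      exact hφi.norm.mul_const _
    · filter_upwards with t ht
      have ht' := hI ht
      apply HasSum.mul_left
      apply hs
      rw [norm_mul, norm_real, Real.norm_of_nonneg ht'.1]
      exact lt_of_le_of_lt (mul_le_of_le_one_right (norm_nonneg _) ht'.2) hw
  have hcre : 0 < c.re := by simp at hcb; linarith
  have hGc := Gamma_ne_zero_of_re_pos hcre
  have hGb := Gamma_ne_zero_of_re_pos hb
  have hGcb := Gamma_ne_zero_of_re_pos hcb
  refine ⟨fun w => Gamma c / (Gamma b * Gamma (c - b)) * f w, ?_, ?_⟩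
  · apply DifferentiableOn.analyticOnNhd _ isOpen_slitDomain
    intro x hx
    exact ((hdiff x hx).const_mul _).differentiableWithinAt
  · intro w hw
    refine (congrArg (fun F => HasSum F _) (funext fun n => ?_)).mp
      ((hsum w hw).mul_left (Gamma c / (Gamma b * Gamma (c - b))))
    symm
    have hpos : ∀ z : ℂ, 0 < z.re → ∀ k : ℕ, z ≠ -k := by
      rintro z hz k rfl
      simp at hz
      linarith [k.cast_nonneg (α := ℝ)]
    rw [betaIntegral_eq_Gamma_mul_div _ _ (by simp; positivity) hcb,
      ← Gamma_add_nat_div_Gamma_eq b (hpos b hb), ← Gamma_add_nat_div_Gamma_eq c (hpos c hcre)]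
    have h1 : b + n + (c - b) = c + n := by ring
    have h2 : Gamma (c + n) ≠ 0 := Gamma_ne_zero_of_re_pos (by simp; positivity)
    have h3 : (n.factorial : ℂ) ≠ 0 := by exact_mod_cast n.factorial_ne_zero
    rw [h1]
    field_simp

theorem ascPochhammer_eval_succ_left (x : ℂ) (n : ℕ) : (ascPochhammer ℂ (n + 1)).eval x =
    x * (ascPochhammer ℂ n).eval (x + 1) := by
  simp [ascPochhammer_succ_left]

theorem continuation_of_contiguous {a b c : ℂ} {k : ℂ} {b' c' : ℂ}
    (h0 : ∀ n : ℕ, (ascPochhammer ℂ (n + 1)).eval a * (ascPochhammer ℂ (n + 1)).eval b /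
      ((ascPochhammer ℂ (n + 1)).eval c * ((n + 1).factorial : ℂ)) =
      (ascPochhammer ℂ (n + 1)).eval a * (ascPochhammer ℂ (n + 1)).eval b' /
      ((ascPochhammer ℂ (n + 1)).eval c' * ((n + 1).factorial : ℂ)) +
      k * ((ascPochhammer ℂ n).eval (a + 1) * (ascPochhammer ℂ n).eval (b + 1) /
      ((ascPochhammer ℂ n).eval (c + 2) * (n.factorial : ℂ))))
    (h1 : ∃ f, IsGaussContinuation a b' c' f)
    (h2 : ∃ f, IsGaussContinuation (a + 1) (b + 1) (c + 2) f) :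
    ∃ f, IsGaussContinuation a b c f := by
  obtain ⟨f, hf⟩ := h1
  obtain ⟨g, hg⟩ := h2
  refine ⟨fun w => f w + k * (w * g w), ?_, ?_⟩
  · exact hf.analytic.add (analyticOnNhd_const.mul (analyticOnNhd_id.mul hg.analytic))
  · intro w hw
    have h1 := (hasSum_nat_add_iff' 1).2 (hf.hasSum w hw)
    have h2 := (hg.hasSum w hw).mul_left (k * w)
    rw [← hasSum_nat_add_iff' 1]
    convert h1.add h2 using 1
    · funext n
      rw [h0]
      ring
    · simp
      ring

theorem exists_continuation (a b c : ℂ) (hc : ∀ n : ℕ, c ≠ -n) :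
    ∃ f, IsGaussContinuation a b c f := by
  have hne : ∀ c : ℂ, (∀ n : ℕ, c ≠ -n) → ∀ n : ℕ, c + n ≠ 0 := by
    intro c hc n h
    exact hc n (eq_neg_of_add_eq_zero_left h)
  have hshift : ∀ c : ℂ, (∀ n : ℕ, c ≠ -n) → ∀ m : ℕ, ∀ n : ℕ, c + m ≠ -n := by
    intro c hc m n h
    apply hc (m + n)
    push_cast
    linear_combination h
  have hpoch : ∀ c : ℂ, (∀ n : ℕ, c ≠ -n) → ∀ n : ℕ, (ascPochhammer ℂ n).eval (c + 2) ≠ 0 := by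
    intro c hc n h
    obtain ⟨k, -, hk⟩ := (ascPochhammer_eval_eq_zero_iff n _).1 h
    exact hshift c hc 2 k (by push_cast; rw [hk]; ring)
  have hcpoch : ∀ c : ℂ, (∀ n : ℕ, c ≠ -n) → ∀ n : ℕ, (ascPochhammer ℂ (n + 1)).eval c =
      c * (c + 1) * (ascPochhammer ℂ n).eval (c + 2) / (c + 1 + n) := by
    intro c hc n
    have h := hne c hc (1 + n)
    push_cast at h
    rw [eq_div_iff (by rwa [add_assoc]), ascPochhammer_eval_succ_left, mul_assoc, mul_assoc,
      ← ascPochhammer_succ_eval, ascPochhammer_eval_succ_left]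
    congr 3
    ring
  have h12 : ∀ c : ℂ, c + 1 + 1 = c + 2 := fun c => by ring
  -- shift `c` by one
  have stepC : ∀ N : ℕ, ∀ a b c : ℂ, (∀ n : ℕ, c ≠ -n) → 0 < b.re → -(N : ℝ) < (c - b).re →
      ∃ f, IsGaussContinuation a b c f := by
    intro N
    induction N with
    | zero =>
      intro a b c _ hb hcb
      exact exists_continuation_of_re_pos a b c hb (by simpa using hcb)
    | succ N ih =>
      intro a b c hc hb hcb
      push_cast at hcb
      simp only [sub_re] at hcb
      refine continuation_of_contiguous (b' := b) (c' := c + 1) (k := a * b / (c * (c + 1))) ?_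
        (ih _ _ _ (by simpa using hshift c hc 1) hb ?_)
        (ih _ _ _ (by simpa using hshift c hc 2) (by simp; linarith) ?_)
      · intro n
        have e0 : c ≠ 0 := by simpa using hc 0
        have e1 : c + 1 ≠ 0 := by simpa using hne c hc 1
        have e2 : c + 1 + n ≠ 0 := by simpa [add_assoc] using hne c hc (1 + n)
        have e3 := hpoch c hc n
        have e4 : (n.factorial : ℂ) ≠ 0 := by exact_mod_cast n.factorial_ne_zero
        have e5 : (n : ℂ) + 1 ≠ 0 := by exact_mod_cast n.succ_ne_zero
        rw [hcpoch c hc n, ascPochhammer_eval_succ_left (c + 1), h12, ascPochhammer_eval_succ_left a, ascPochhammer_eval_succ_left b, Nat.factorial_succ]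
        push_cast
        field_simp
        ring
      · simp only [sub_re, add_re, one_re]; linarith
      · simp only [sub_re, add_re, one_re]; norm_num; linarith
  -- shift `b` and `c` by one
  have stepB : ∀ N : ℕ, ∀ a b c : ℂ, (∀ n : ℕ, c ≠ -n) → -(N : ℝ) < b.re →
      ∃ f, IsGaussContinuation a b c f := by
    intro N
    induction N with
    | zero =>
      intro a b c hc hb
      obtain ⟨M, hM⟩ := exists_nat_gt (-(c - b).re)
      exact stepC M a b c hc (by simpa using hb) (by linarith)
    | succ N ih =>
      intro a b c hc hb
      push_cast at hb
      have hb' : -(N : ℝ) < (b + 1).re := by simp only [add_re, one_re]; linarith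
      refine continuation_of_contiguous (b' := b + 1) (c' := c + 1) (k := - (a * (c - b) / (c * (c + 1)))) ?_
        (ih _ _ _ (by simpa using hshift c hc 1) hb')
        (ih _ _ _ (by simpa using hshift c hc 2) hb')
      intro n
      have e0 : c ≠ 0 := by simpa using hc 0
      have e1 : c + 1 ≠ 0 := by simpa using hne c hc 1
      have e2 : c + 1 + n ≠ 0 := by simpa [add_assoc] using hne c hc (1 + n)
      have e3 := hpoch c hc n
      have e4 : (n.factorial : ℂ) ≠ 0 := by exact_mod_cast n.factorial_ne_zero
      have e5 : (n : ℂ) + 1 ≠ 0 := by exact_mod_cast n.succ_ne_zero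
      rw [hcpoch c hc n, ascPochhammer_eval_succ_left (c + 1), h12, ascPochhammer_eval_succ_left a, ascPochhammer_eval_succ_left b,
        ascPochhammer_succ_eval n (b + 1), Nat.factorial_succ]
      push_cast
      field_simp
      ring
  obtain ⟨N, hN⟩ := exists_nat_gt (-b.re)
  exact stepB N a b c hc (by linarith)

theorem isGaussContinuation_hypF (a b c : ℂ) (hc : ∀ n : ℕ, c ≠ -n) :
    IsGaussContinuation a b c (hypF a b c) :=
  Classical.epsilon_spec (exists_continuation a b c hc)

theorem IsGaussContinuation.eqOn {a b c : ℂ} {f g : ℂ → ℂ} (hf : IsGaussContinuation a b c f)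
    (hg : IsGaussContinuation a b c g) : EqOn f g slitDomain := by
  have h0 : (0 : ℂ) ∈ slitDomain := by
    rintro ⟨x, hx, h⟩
    have hx0 : x = 0 := by exact_mod_cast h
    rw [hx0] at hx
    exact absurd (mem_Ici.1 hx) (by norm_num)
  have hstar : StarConvex ℝ 0 slitDomain := by
    rw [starConvex_zero_iff]
    rintro y hy t ht0 ht1 ⟨x, hx, h⟩
    have ht : 0 < t := by
      rcases ht0.eq_or_lt with h' | h'
      · rw [← h', zero_smul] at h
        exact absurd ⟨x, hx, h⟩ h0
      · exact h'
    refine hy ⟨x / t, ?_, ?_⟩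
    · exact mem_Ici.2 ((one_le_div ht).2 (ht1.trans hx))
    · have htc : (t : ℂ) ≠ 0 := by exact_mod_cast ht.ne.symm
      push_cast
      rw [h, real_smul]
      field_simp
  refine hf.analytic.eqOn_of_preconnected_of_eventuallyEq hg.analytic
    (hstar.isPathConnected h0).isConnected.isPreconnected h0 ?_
  filter_upwards [Metric.ball_mem_nhds (0 : ℂ) one_pos] with w hw
  have hw' : ‖w‖ < 1 := by simpa using hw
  exact (hf.hasSum w hw').unique (hg.hasSum w hw')

end Hypergeometric

section Coefficients

/-- The partial numerators `c₁, c₂, …` of the continued fraction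
`F(a,b,c;w) / F(a,b+1,c+1;w) ∼ 1 + c₁w/(1 + c₂w/(1 + ⋯))`; the value at `0` is not used. -/
noncomputable def cfCoeff (a b c : ℂ) (m : ℕ) : ℂ :=
  let j : ℂ := ((m / 2 : ℕ) : ℂ)
  if Even m then -((b + j) * (c - a + j) / ((c + 2 * j - 1) * (c + 2 * j)))
  else -((a + j) * (c - b + j) / ((c + 2 * j) * (c + 2 * j + 1)))

/-- `dₘ = -cₘ`. -/
noncomputable def dCoeff (a b c : ℂ) (m : ℕ) : ℂ := -cfCoeff a b c m

/-- Diagonal J-fraction coefficients: `a₀ = 2 - 4d₂` and `aₙ = 2 - 4d₂ₙ₊₁ - 4d₂ₙ₊₂` for `n ≥ 1`. -/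
noncomputable def jDiag (a b c : ℂ) (n : ℕ) : ℂ :=
  if n = 0 then 2 - 4 * dCoeff a b c 2
  else 2 - 4 * dCoeff a b c (2 * n + 1) - 4 * dCoeff a b c (2 * n + 2)

/-- Squared off-diagonal J-fraction coefficients `bₖ² = 16 d₂ₖ₊₂ d₂ₖ₊₃`. -/
noncomputable def jOffSq (a b c : ℂ) (k : ℕ) : ℂ :=
  16 * dCoeff a b c (2 * k + 2) * dCoeff a b c (2 * k + 3)

/-- The closed form of `bₖ²`. -/
theorem jOffSq_eq (a b c : ℂ) (k : ℕ) :
    jOffSq a b c k = 16 * ((a + k + 1) * (c - b + k + 1) * (b + k + 1) * (c - a + k + 1) /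
      ((c + 2 * k + 2) ^ 2 * (c + 2 * k + 3) * (c + 2 * k + 1))) := by
  have e1 : Even (2 * k + 2) := ⟨k + 1, by ring⟩
  have e2 : ¬ Even (2 * k + 3) := by
    rw [Nat.not_even_iff_odd]
    exact ⟨k + 1, by ring⟩
  have h1 : (2 * k + 2) / 2 = k + 1 := by omega
  have h2 : (2 * k + 3) / 2 = k + 1 := by omega
  simp only [jOffSq, dCoeff, cfCoeff, if_pos e1, if_neg e2, h1, h2]
  push_cast
  rw [show c + 2 * ((k : ℂ) + 1) - 1 = c + 2 * k + 1 by ring,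
    show c + 2 * ((k : ℂ) + 1) = c + 2 * k + 2 by ring,
    show c + 2 * (k : ℂ) + 2 + 1 = c + 2 * k + 3 by ring, neg_neg, neg_neg, mul_assoc,
    div_mul_div_comm]
  congr 2 <;> ring

/-- `B(a, b, c; z)`; meaningful when `d₁ ≠ 0`, `z ∉ [-2, 2]` and the denominator
`F(a, b + 1, c + 1; -4 / (z - 2))` does not vanish. -/
noncomputable def bFun (a b c z : ℂ) : ℂ :=
  -1 / (4 * dCoeff a b c 1) *
    (hypF a b c (-4 / (z - 2)) / hypF a (b + 1) (c + 1) (-4 / (z - 2)) - 1)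

end Coefficients

section Operators

open scoped ENNReal

/-- The Hilbert space of complex square-summable sequences. -/
abbrev EllTwo : Type := lp (fun _ : ℕ => ℂ) 2

/-- The bounded operator `T` acts on `ℓ²` by the infinite matrix `M`. -/
def IsMatrixOperator (M : Matrix ℕ ℕ ℂ) (T : EllTwo →L[ℂ] EllTwo) : Prop :=
  ∀ (x : EllTwo) (i : ℕ), HasSum (fun j => M i j * x j) ((T x) i)

/-- The bounded operator on `ℓ²` generated by `M`, if there is one (it is then unique,
`isMatrixOperator_unique`). -/
noncomputable def matrixOperator (M : Matrix ℕ ℕ ℂ) : EllTwo →L[ℂ] EllTwo :=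
  Classical.epsilon (IsMatrixOperator M)

/-- The symmetric tridiagonal matrix with diagonal `α` and off-diagonals `β`. -/
def jacobiMatrix (α β : ℕ → ℂ) : Matrix ℕ ℕ ℂ := fun i j =>
  if i = j then α i else if i = j + 1 then β j else if j = i + 1 then β i else 0

/-- The operator on `ℓ²` generated by the Jacobi matrix. -/
noncomputable def jacobiOperator (α β : ℕ → ℂ) : EllTwo →L[ℂ] EllTwo :=
  matrixOperator (jacobiMatrix α β)

/-- The free Jacobi matrix `J₀`. -/
noncomputable def freeJacobi : EllTwo →L[ℂ] EllTwo :=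
  jacobiOperator (fun _ => 0) (fun _ => 1)

/-- `e = (1, 0, 0, …)`. -/
noncomputable def e₀ : EllTwo := lp.single 2 0 1

/-- `T` is trace class: the trace `∑ ⟨|T| vᵢ, vᵢ⟩` of `|T| = (T* T)^{1/2}` is finite in every
orthonormal basis. -/
def IsTraceClass.{u} {H : Type u} [NormedAddCommGroup H] [InnerProductSpace ℂ H] [CompleteSpace H]
    (T : H →L[ℂ] H) : Prop :=
  ∀ {ι : Type u} (v : HilbertBasis ι ℂ H),
    Summable fun i => (inner ℂ (v i) (CFC.abs T (v i))).re

theorem isMatrixOperator_unique {M : Matrix ℕ ℕ ℂ} {S T : EllTwo →L[ℂ] EllTwo}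
    (hS : IsMatrixOperator M S) (hT : IsMatrixOperator M T) : S = T := by
  ext x i
  exact (hS x i).unique (hT x i)

theorem exists_weighted (m : ℕ → ℂ) (C : ℝ) (hm : ∀ n, ‖m n‖ ≤ C) (σ : ℕ → ℕ)
    (hσ : Function.Injective σ) :
    ∃ T : EllTwo →L[ℂ] EllTwo, ∀ x n, (T x) n = m n * x (σ n) := by
  have hC : 0 ≤ C := (norm_nonneg _).trans (hm 0)
  have hp : 0 < (2 : ℝ≥0∞).toReal := by norm_num
  have hx : ∀ x : EllTwo, Summable fun n => ‖x n‖ ^ (2 : ℝ≥0∞).toReal := fun x =>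
    (lp.memℓp x).summable hp
  have hle : ∀ (x : EllTwo) n, ‖m n * x (σ n)‖ ^ (2 : ℝ≥0∞).toReal ≤
      C ^ (2 : ℝ≥0∞).toReal * ‖x (σ n)‖ ^ (2 : ℝ≥0∞).toReal := by
    intro x n
    rw [norm_mul, Real.mul_rpow (norm_nonneg _) (norm_nonneg _)]
    gcongr
    exact hm n
  have hsum : ∀ x : EllTwo, Summable fun n =>
      C ^ (2 : ℝ≥0∞).toReal * ‖x (σ n)‖ ^ (2 : ℝ≥0∞).toReal := fun x =>
    ((hx x).comp_injective hσ).mul_left _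
  have hmem : ∀ x : EllTwo, Memℓp (fun n => m n * x (σ n)) 2 := fun x =>
    memℓp_gen (Summable.of_nonneg_of_le (fun n => by positivity) (hle x) (hsum x))
  let L : EllTwo →ₗ[ℂ] EllTwo :=
    { toFun := fun x => ⟨fun n => m n * x (σ n), hmem x⟩
      map_add' := fun x y => by
        ext n
        simp [mul_add]
        rfl
      map_smul' := fun r x => by
        ext n
        simp
        ring }
  refine ⟨L.mkContinuous C fun x => ?_, fun x n => rfl⟩
  refine lp.norm_le_of_tsum_le hp (by positivity) ?_
  rw [Real.mul_rpow hC (norm_nonneg _), lp.norm_rpow_eq_tsum hp x, ← tsum_mul_left]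
  calc ∑' n, ‖(L x) n‖ ^ (2 : ℝ≥0∞).toReal
      ≤ ∑' n, C ^ (2 : ℝ≥0∞).toReal * ‖x (σ n)‖ ^ (2 : ℝ≥0∞).toReal :=
        Summable.tsum_le_tsum (hle x)
          (Summable.of_nonneg_of_le (fun n => by positivity) (hle x) (hsum x)) (hsum x)
    _ ≤ _ := by
        exact tsum_comp_le_tsum_of_inj ((hx x).mul_left _) (fun n => by positivity) hσ

theorem isMatrixOperator_jacobi (α β : ℕ → ℂ) (C : ℝ) (hα : ∀ n, ‖α n‖ ≤ C)
    (hβ : ∀ n, ‖β n‖ ≤ C) :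
    IsMatrixOperator (jacobiMatrix α β) (matrixOperator (jacobiMatrix α β)) := by
  have hex : ∃ T, IsMatrixOperator (jacobiMatrix α β) T := by
    obtain ⟨D, hD⟩ := exists_weighted α C hα id Function.injective_id
    obtain ⟨U, hU⟩ := exists_weighted β C hβ Nat.succ Nat.succ_injective
    obtain ⟨V, hV⟩ := exists_weighted (fun n => star (β n)) C (by simpa using hβ) Nat.succ
      Nat.succ_injective
    have hW : ∀ (x : EllTwo) n, (ContinuousLinearMap.adjoint V x) n =
        inner ℂ (V (lp.single 2 n 1)) x := by
      intro x n
      rw [← ContinuousLinearMap.adjoint_inner_right, lp.inner_single_left]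
      simp
    have hV0 : V (lp.single 2 0 1) = 0 := by
      ext n
      simp [hV]
    have hVs : ∀ n, V (lp.single 2 (n + 1) 1) = lp.single 2 n (star (β n)) := by
      intro n
      ext k
      by_cases h : k = n <;> simp [hV, h]
    refine ⟨D + U + ContinuousLinearMap.adjoint V, fun x i => ?_⟩
    have hval : ((D + U + ContinuousLinearMap.adjoint V) x) i =
        α i * x i + β i * x (i + 1) + (ContinuousLinearMap.adjoint V x) i := by
      simp [hD, hU]
    rw [hval, hW]
    rcases i with _ | i
    · rw [hV0, inner_zero_left]
      refine (congrArg (fun F => HasSum F _) (funext fun j => ?_)).mp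
        (((hasSum_ite_eq 0 (α 0 * x 0)).add (hasSum_ite_eq 1 (β 0 * x 1))).add
          (hasSum_zero (α := ℂ)))
      rcases j with _ | _ | j <;> simp [jacobiMatrix]
    · rw [hVs, lp.inner_single_left]
      refine (congrArg (fun F => HasSum F _) (funext fun j => ?_)).mp
        (((hasSum_ite_eq (i + 1) (α (i + 1) * x (i + 1))).add
          (hasSum_ite_eq (i + 2) (β (i + 1) * x (i + 2)))).add (hasSum_ite_eq i _))
      simp only [jacobiMatrix]
      by_cases h1 : j = i + 1
      · subst h1; simp
      by_cases h2 : j = i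
      · subst h2; simp [mul_comm]
      by_cases h3 : j = i + 2
      · subst h3; simp
      rw [if_neg h1, if_neg h2, if_neg h3, if_neg (Ne.symm h1), if_neg (by omega),
        if_neg (by omega)]
      simp
  exact Classical.epsilon_spec hex

theorem isMatrixOperator_freeJacobi :
    IsMatrixOperator (jacobiMatrix (fun _ => 0) (fun _ => 1)) freeJacobi :=
  isMatrixOperator_jacobi _ _ 1 (by simp) (by simp)

end Operators

end HypJacobi

open HypJacobi

namespace HypJacobi

open Complex Set Filter Topology

/-! ### The Gauss hypergeometric function on the cut plane -/

/-! Put `w = -4/(z-2)`, which carries the complement of `[-2,2]` into the cut plane. Two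
applications of Gauss' contiguous relation eliminate the odd functions `F(a+n, b+n+1, c+2n+1)` and
leave a three-term recurrence for `Eₙ = F(a+n, b+n, c+2n)` (`evenF_three_term`). After
multiplication by `∏ (-w βₖ/4)` it becomes the recurrence of `J - z`. The resulting vector `y`, with
`y₀ = E₁`, solves every row except the first, where the defect is `-(z-2) F(a,b+1,c+1;w)`. Hence, if
`y ∈ ℓ²`, then `(J - z)y = -(z-2) F(a,b+1,c+1;w) e`; applying the inverse and reading entry `0`
gives the formula for `B` (`mFunction_eq`). If the denominator vanished, then `y = 0` and
`F(a+1,b+1,c+2;w) = 0` too. Such a common zero is impossible: the two functions solve a linear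
first-order system, regular away from `0` and `1` (`hypF_no_common_zero`).

The analytic point is `y ∈ ℓ²`. For small `w` crude bounds on the Gauss series suffice. For general
`z` no asymptotics are used: the operators `J_N` with `N` rows and columns removed tend to `J₀` in
norm, so for large `N` a compact segment joining `z` to a far point lies in the resolvent set of
`J_N`. At the far end the tail of `y` is a multiple of the resolvent vector of `J_N`; the identity
continues analytically along the segment, and its right side is always in `ℓ²`
(`exists_memℓp_tailSol`).

The coefficients differ from those of `J₀` by `O(n⁻²)`. This gives boundedness, the trace class
property (`isTraceClass_of_summable_norm`), and, through wave packets far out, the inclusion of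
`[-2,2]` in the spectrum (`notMem_of_mem_resolventSet`). -/

theorem zero_mem_slitDomain : (0 : ℂ) ∈ slitDomain := by
  rintro ⟨x, hx, h⟩
  have hx0 : x = 0 := by exact_mod_cast h
  rw [hx0] at hx
  exact absurd (mem_Ici.1 hx) (by norm_num)

theorem real_mul_mem_slitDomain {y : ℂ} (hy : y ∈ slitDomain) {t : ℝ} (h0 : 0 ≤ t) (h1 : t ≤ 1) :
    (t : ℂ) * y ∈ slitDomain := by
  rintro ⟨x, hx, h⟩
  have ht : 0 < t := by
    rcases h0.eq_or_lt with h' | h'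
    · rw [← h', ofReal_zero, zero_mul] at h
      exact absurd ⟨x, hx, h⟩ zero_mem_slitDomain
    · exact h'
  refine hy ⟨x / t, mem_Ici.2 ((one_le_div ht).2 (h1.trans hx)), ?_⟩
  have htc : (t : ℂ) ≠ 0 := by exact_mod_cast ht.ne'
  push_cast
  rw [h]
  field_simp

theorem isPreconnected_slitDomain : IsPreconnected slitDomain := by
  have hstar : StarConvex ℝ 0 slitDomain := by
    rw [starConvex_zero_iff]
    intro y hy t h0 h1
    simpa using real_mul_mem_slitDomain hy h0 h1
  exact (hstar.isPathConnected zero_mem_slitDomain).isConnected.isPreconnected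

theorem mem_slitDomain_of_norm_lt {w : ℂ} (hw : ‖w‖ < 1) : w ∈ slitDomain := by
  rintro ⟨x, hx, rfl⟩
  rw [norm_real, Real.norm_of_nonneg (zero_le_one.trans hx)] at hw
  exact absurd (mem_Ici.1 hx) (not_le.2 hw)

theorem ne_one_of_mem_slitDomain {w : ℂ} (hw : w ∈ slitDomain) : w ≠ 1 := by
  rintro rfl
  exact hw ⟨1, mem_Ici.2 le_rfl, by simp⟩

/-- The identity theorem reduces each functional relation on the cut plane to a comparison of Taylor
coefficients. The radius is free because the relations with a derivative are checked only for `‖w‖ <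
1/2`. -/
theorem eqOn_slitDomain {f g : ℂ → ℂ} (hf : AnalyticOnNhd ℂ f slitDomain)
    (hg : AnalyticOnNhd ℂ g slitDomain) {r : ℝ} (hr : 0 < r)
    (h : ∀ w : ℂ, ‖w‖ < r → f w = g w) : EqOn f g slitDomain := by
  refine hf.eqOn_of_preconnected_of_eventuallyEq hg isPreconnected_slitDomain
    zero_mem_slitDomain ?_
  filter_upwards [Metric.ball_mem_nhds (0 : ℂ) hr] with w hw
  exact h w (by simpa using hw)

/-- The coefficients of the Gauss series. -/
noncomputable def gaussCoeff (a b c : ℂ) (n : ℕ) : ℂ :=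
  (ascPochhammer ℂ n).eval a * (ascPochhammer ℂ n).eval b /
    ((ascPochhammer ℂ n).eval c * (n.factorial : ℂ))

/-! ### Gauss coefficients and the contiguous relation -/

theorem gaussCoeff_zero (a b c : ℂ) : gaussCoeff a b c 0 = 1 := by simp [gaussCoeff]

theorem add_natCast_ne_zero {c : ℂ} (hc : ∀ n : ℕ, c ≠ -n) (n : ℕ) : c + n ≠ 0 :=
  fun h => hc n (eq_neg_of_add_eq_zero_left h)

theorem shift_ne_neg_natCast {c : ℂ} (hc : ∀ n : ℕ, c ≠ -n) (m : ℕ) (n : ℕ) : c + m ≠ -n := by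
  intro h
  apply hc (m + n)
  push_cast
  linear_combination h

theorem ascPochhammer_eval_ne_zero {c : ℂ} (hc : ∀ n : ℕ, c ≠ -n) (n : ℕ) :
    (ascPochhammer ℂ n).eval c ≠ 0 := by
  intro h
  obtain ⟨k, -, hk⟩ := (ascPochhammer_eval_eq_zero_iff n _).1 h
  exact hc k (by rw [hk]; ring)

theorem ascPochhammer_eval_mul_add (x : ℂ) (n : ℕ) :
    (ascPochhammer ℂ n).eval x * (x + n) = x * (ascPochhammer ℂ n).eval (x + 1) := by
  rw [← ascPochhammer_succ_eval, ascPochhammer_eval_succ_left]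

theorem gaussCoeff_succ {c : ℂ} (hc : ∀ n : ℕ, c ≠ -n) (a b : ℂ) (n : ℕ) :
    gaussCoeff a b c (n + 1) =
      gaussCoeff a b c n * ((a + n) * (b + n) / ((c + n) * (n + 1))) := by
  have h1 := ascPochhammer_eval_ne_zero hc n
  have h2 := add_natCast_ne_zero hc n
  have h3 : (n.factorial : ℂ) ≠ 0 := by exact_mod_cast n.factorial_ne_zero
  have h4 : (n : ℂ) + 1 ≠ 0 := by exact_mod_cast n.succ_ne_zero
  simp only [gaussCoeff, ascPochhammer_succ_eval, Nat.factorial_succ]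
  push_cast
  field_simp

theorem hypF_comm (a b c : ℂ) : hypF a b c = hypF b a c := by
  have : IsGaussContinuation a b c = IsGaussContinuation b a c := by
    funext f
    apply propext
    constructor <;> rintro ⟨h1, h2⟩ <;> refine ⟨h1, fun w hw => ?_⟩ <;>
      simpa only [mul_comm (Polynomial.eval a _)] using h2 w hw
  rw [hypF, hypF, this]

theorem hypF_analytic {c : ℂ} (hc : ∀ n : ℕ, c ≠ -n) (a b : ℂ) :
    AnalyticOnNhd ℂ (hypF a b c) slitDomain :=
  (isGaussContinuation_hypF a b c hc).analytic

theorem hypF_hasSum {c : ℂ} (hc : ∀ n : ℕ, c ≠ -n) (a b : ℂ) {w : ℂ} (hw : ‖w‖ < 1) :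
    HasSum (fun n => gaussCoeff a b c n * w ^ n) (hypF a b c w) :=
  (isGaussContinuation_hypF a b c hc).hasSum w hw

theorem hypF_zero {c : ℂ} (hc : ∀ n : ℕ, c ≠ -n) (a b : ℂ) : hypF a b c 0 = 1 := by
  refine (hypF_hasSum hc a b (w := 0) (by simp)).unique ?_
  convert! hasSum_single 0 fun n hn => ?_
  · simp [gaussCoeff_zero]
  · simp [hn]

theorem HasSum.mul_shift {u : ℕ → ℂ} {w s : ℂ} (h : HasSum (fun n => u n * w ^ n) s) :
    HasSum (fun n => (if n = 0 then 0 else u (n - 1)) * w ^ n) (w * s) := by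
  rw [← hasSum_nat_add_iff' 1]
  simp only [Nat.add_eq_zero_iff, one_ne_zero, and_false, if_false, Nat.add_sub_cancel]
  simpa [pow_succ, mul_assoc, mul_comm, mul_left_comm] using h.mul_left w

/-- Gauss' contiguous relation behind the continued fraction. -/
theorem hypF_contiguous {c : ℂ} (hc : ∀ n : ℕ, c ≠ -n) (a b : ℂ) {w : ℂ} (hw : w ∈ slitDomain) :
    hypF a b c w = hypF a (b + 1) (c + 1) w -
      a * (c - b) / (c * (c + 1)) * (w * hypF (a + 1) (b + 1) (c + 2) w) := by
  have hc1 : ∀ n : ℕ, c + 1 ≠ -n := by simpa using shift_ne_neg_natCast hc 1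
  have hc2 : ∀ n : ℕ, c + 2 ≠ -n := by simpa using shift_ne_neg_natCast hc 2
  refine eqOn_slitDomain (hypF_analytic hc a b) (g := fun w => hypF a (b + 1) (c + 1) w -
      a * (c - b) / (c * (c + 1)) * (w * hypF (a + 1) (b + 1) (c + 2) w))
    ((hypF_analytic hc1 _ _).sub
      (analyticOnNhd_const.mul (analyticOnNhd_id.mul (hypF_analytic hc2 _ _))))
    one_pos (fun w hw => ?_) hw
  refine (hypF_hasSum hc a b hw).unique ?_
  refine (congrArg (fun F => HasSum F _) (funext fun n => ?_)).mp ((hypF_hasSum hc1 a (b + 1) hw).sub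
    ((HasSum.mul_shift (hypF_hasSum hc2 (a + 1) (b + 1) hw)).mul_left _))
  rcases n with _ | n
  · simp [gaussCoeff_zero]
  · have e0 : c ≠ 0 := by simpa using hc 0
    have e1 : c + 1 ≠ 0 := by simpa using add_natCast_ne_zero hc 1
    have e2 : c + 1 + n ≠ 0 := add_natCast_ne_zero hc1 n
    have e3 := ascPochhammer_eval_ne_zero hc2 n
    have e4 : (n.factorial : ℂ) ≠ 0 := by exact_mod_cast n.factorial_ne_zero
    have e5 : (n : ℂ) + 1 ≠ 0 := by exact_mod_cast n.succ_ne_zero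
    have h12 : c + 1 + 1 = c + 2 := by ring
    have h3 : (ascPochhammer ℂ n).eval (c + 1) =
        (c + 1) * (ascPochhammer ℂ n).eval (c + 2) / (c + 1 + n) := by
      rw [eq_div_iff e2, ascPochhammer_eval_mul_add, h12]
    simp only [gaussCoeff, ascPochhammer_eval_succ_left c, h3, ascPochhammer_eval_succ_left (c + 1),
      h12, ascPochhammer_eval_succ_left a, ascPochhammer_eval_succ_left b,
      ascPochhammer_succ_eval n (b + 1), Nat.factorial_succ, Nat.add_sub_cancel, n.succ_ne_zero,
      if_false]
    push_cast
    field_simp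
    ring

/-! ### Derivative relations and the absence of common zeros -/

theorem hypF_mul_deriv_hasSum {c : ℂ} (hc : ∀ n : ℕ, c ≠ -n) (a b : ℂ) {w : ℂ}
    (hw : ‖w‖ < 1 / 2) :
    HasSum (fun n : ℕ => n * gaussCoeff a b c n * w ^ n) (w * deriv (hypF a b c) w) := by
  -- Absolute convergence at `1/2` dominates the series on the whole ball of that radius, so it may
  -- be differentiated termwise there.
  have hs : Summable fun n => ‖gaussCoeff a b c n‖ * (1 / 2 : ℝ) ^ n := by
    have := (hypF_hasSum hc a b (w := 1 / 2) (by norm_num)).summable.norm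
    simpa using this
  have hwm : w ∈ Metric.ball (0 : ℂ) (1 / 2) := by simpa using hw
  have key := hasSum_deriv_of_summable_norm (F := fun n w => gaussCoeff a b c n * w ^ n) hs
    (fun n => by fun_prop) Metric.isOpen_ball (fun n v hv => ?_) hwm
  · have hd : deriv (fun w => ∑' n, gaussCoeff a b c n * w ^ n) w = deriv (hypF a b c) w := by
      apply Filter.EventuallyEq.deriv_eq
      filter_upwards [Metric.isOpen_ball.mem_nhds hwm] with v hv
      have hv' : ‖v‖ < 1 / 2 := by simpa using hv
      exact (hypF_hasSum hc a b (hv'.trans (by norm_num))).tsum_eq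
    rw [hd] at key
    refine (congrArg (fun F => HasSum F _) (funext fun n => ?_)).mp (key.mul_left w)
    rcases n with _ | n
    · simp
    · rw [((hasDerivAt_pow (n + 1) w).const_mul (gaussCoeff a b c (n + 1))).deriv,
        Nat.add_sub_cancel, pow_succ]
      ring
  · have hv' : ‖v‖ < 1 / 2 := by simpa using hv
    rw [norm_mul, norm_pow]
    gcongr

/-- `(ϑ + a) F(a, b, c) = a F(a + 1, b, c)`. -/
theorem hypF_raise_left {c : ℂ} (hc : ∀ n : ℕ, c ≠ -n) (a b : ℂ) {w : ℂ} (hw : w ∈ slitDomain) :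
    w * deriv (hypF a b c) w + a * hypF a b c w = a * hypF (a + 1) b c w := by
  refine eqOn_slitDomain (f := fun w => w * deriv (hypF a b c) w + a * hypF a b c w)
    (g := fun w => a * hypF (a + 1) b c w) ((analyticOnNhd_id.mul (hypF_analytic hc a b).deriv).add
      (analyticOnNhd_const.mul (hypF_analytic hc a b)))
    (analyticOnNhd_const.mul (hypF_analytic hc (a + 1) b)) (r := 1 / 2) (by norm_num)
    (fun w hw => ?_) hw
  have hw1 : ‖w‖ < 1 := hw.trans (by norm_num)
  refine ((hypF_mul_deriv_hasSum hc a b hw).add ((hypF_hasSum hc a b hw1).mul_left a)).unique ?_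
  refine (congrArg (fun F => HasSum F _) (funext fun n => ?_)).mp
    ((hypF_hasSum hc (a + 1) b hw1).mul_left a)
  have h := ascPochhammer_eval_mul_add a n
  simp only [gaussCoeff]
  linear_combination (-(ascPochhammer ℂ n).eval b /
    ((ascPochhammer ℂ n).eval c * (n.factorial : ℂ)) * w ^ n) * h

/-- `(ϑ + c) F(a, b, c + 1) = c F(a, b, c)`. -/
theorem hypF_lower_right {c : ℂ} (hc : ∀ n : ℕ, c ≠ -n) (a b : ℂ) {w : ℂ} (hw : w ∈ slitDomain) :
    w * deriv (hypF a b (c + 1)) w + c * hypF a b (c + 1) w = c * hypF a b c w := by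
  have hc1 : ∀ n : ℕ, c + 1 ≠ -n := by simpa using shift_ne_neg_natCast hc 1
  refine eqOn_slitDomain (f := fun w => w * deriv (hypF a b (c + 1)) w + c * hypF a b (c + 1) w)
    (g := fun w => c * hypF a b c w) ((analyticOnNhd_id.mul (hypF_analytic hc1 a b).deriv).add
      (analyticOnNhd_const.mul (hypF_analytic hc1 a b)))
    (analyticOnNhd_const.mul (hypF_analytic hc a b)) (r := 1 / 2) (by norm_num)
    (fun w hw => ?_) hw
  have hw1 : ‖w‖ < 1 := hw.trans (by norm_num)
  refine ((hypF_mul_deriv_hasSum hc1 a b hw).add ((hypF_hasSum hc1 a b hw1).mul_left c)).unique ?_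
  refine (congrArg (fun F => HasSum F _) (funext fun n => ?_)).mp
    ((hypF_hasSum hc a b hw1).mul_left c)
  have h := ascPochhammer_eval_mul_add c n
  have h1 := ascPochhammer_eval_ne_zero hc n
  have h2 := ascPochhammer_eval_ne_zero hc1 n
  have e4 : (n.factorial : ℂ) ≠ 0 := by exact_mod_cast n.factorial_ne_zero
  simp only [gaussCoeff]
  field_simp
  linear_combination -((ascPochhammer ℂ n).eval a * (ascPochhammer ℂ n).eval b * w ^ n) * h

/-- Both derivative relations, the second taken at `a + 1`, produce `F(a+1,b,c)`. Expressing this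
function through `F(a,b,c)` and `F(a+1,b,c+1)` closes the differential system for that pair. -/
theorem hypF_one_sub_mul {c : ℂ} (hc : ∀ n : ℕ, c ≠ -n) (a b : ℂ) {w : ℂ} (hw : w ∈ slitDomain) :
    (1 - w) * hypF (a + 1) b c w =
      hypF a b c w - (c - b) / c * (w * hypF (a + 1) b (c + 1) w) := by
  have hc1 : ∀ n : ℕ, c + 1 ≠ -n := by simpa using shift_ne_neg_natCast hc 1
  refine eqOn_slitDomain (f := fun w => (1 - w) * hypF (a + 1) b c w)
    (g := fun w => hypF a b c w - (c - b) / c * (w * hypF (a + 1) b (c + 1) w))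
    ((analyticOnNhd_const.sub analyticOnNhd_id).mul (hypF_analytic hc _ _))
    ((hypF_analytic hc _ _).sub
      (analyticOnNhd_const.mul (analyticOnNhd_id.mul (hypF_analytic hc1 _ _)))) one_pos
    (fun w hw => ?_) hw
  have hl := hypF_hasSum hc (a + 1) b hw
  have e : (1 - w) * hypF (a + 1) b c w = hypF (a + 1) b c w - w * hypF (a + 1) b c w := by ring
  simp only [e]
  refine (hl.sub (HasSum.mul_shift hl)).unique ?_
  refine (congrArg (fun F => HasSum F _) (funext fun n => ?_)).mp ((hypF_hasSum hc a b hw).sub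
    ((HasSum.mul_shift (hypF_hasSum hc1 (a + 1) b hw)).mul_left _))
  rcases n with _ | n
  · simp [gaussCoeff_zero]
  · have e0 : c ≠ 0 := by simpa using hc 0
    have e2 : c + n ≠ 0 := add_natCast_ne_zero hc n
    have e2' : c + 1 + n ≠ 0 := add_natCast_ne_zero hc1 n
    have e3 := ascPochhammer_eval_ne_zero hc1 n
    have e4 : (n.factorial : ℂ) ≠ 0 := by exact_mod_cast n.factorial_ne_zero
    have e5 : (n : ℂ) + 1 ≠ 0 := by exact_mod_cast n.succ_ne_zero
    have h3 : (ascPochhammer ℂ n).eval c =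
        c * (ascPochhammer ℂ n).eval (c + 1) / (c + n) := by
      rw [eq_div_iff e2, ascPochhammer_eval_mul_add]
    simp only [gaussCoeff, ascPochhammer_eval_succ_left c, h3,
      ascPochhammer_eval_succ_left a, ascPochhammer_succ_eval n (a + 1),
      ascPochhammer_succ_eval n b, Nat.factorial_succ, Nat.add_sub_cancel, n.succ_ne_zero,
      if_false]
    push_cast
    field_simp
    ring

/-- Uniqueness for a first-order analytic linear system with vanishing initial data. -/
theorem eventually_eq_zero_of_linear_system {f g p q r s : ℂ → ℂ} {x : ℂ}
    (hf : AnalyticAt ℂ f x) (hg : AnalyticAt ℂ g x) (hp : AnalyticAt ℂ p x)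
    (hq : AnalyticAt ℂ q x) (hr : AnalyticAt ℂ r x) (hs : AnalyticAt ℂ s x)
    (hf' : deriv f =ᶠ[𝓝 x] p * f + q * g) (hg' : deriv g =ᶠ[𝓝 x] r * f + s * g)
    (hf0 : f x = 0) (hg0 : g x = 0) : ∀ᶠ y in 𝓝 x, f y = 0 := by
  have hmul : ∀ {u v : ℂ → ℂ} {n : ℕ}, AnalyticAt ℂ u x → AnalyticAt ℂ v x →
      (n : ℕ∞) ≤ analyticOrderAt v x → (n : ℕ∞) ≤ analyticOrderAt (u * v) x := by
    intro u v n hu hv h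
    rw [analyticOrderAt_mul hu hv]
    exact h.trans le_add_self
  -- If both functions vanish to order `n`, the system makes both derivatives vanish to order `n`.
  -- Since the values at `x` are zero, the functions then vanish to order `n + 1`; hence the orders
  -- are infinite.
  have key : ∀ n : ℕ, (n : ℕ∞) ≤ analyticOrderAt f x ∧ (n : ℕ∞) ≤ analyticOrderAt g x := by
    intro n
    induction n with
    | zero => simp
    | succ n ih =>
      have h1 : (n : ℕ∞) ≤ analyticOrderAt (deriv f) x := by
        rw [analyticOrderAt_congr hf']
        exact (le_min (hmul hp hf ih.1) (hmul hq hg ih.2)).trans le_analyticOrderAt_add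
      have h2 : (n : ℕ∞) ≤ analyticOrderAt (deriv g) x := by
        rw [analyticOrderAt_congr hg']
        exact (le_min (hmul hr hf ih.1) (hmul hs hg ih.2)).trans le_analyticOrderAt_add
      have h3 := hf.analyticOrderAt_deriv_add_one
      have h4 := hg.analyticOrderAt_deriv_add_one
      simp only [hf0, hg0, sub_zero] at h3 h4
      rw [← h3, ← h4]
      push_cast
      exact ⟨add_le_add_left h1 1, add_le_add_left h2 1⟩
  exact analyticOrderAt_eq_top.1 (ENat.eq_top_iff_forall_ge.2 fun n => (key n).1)

/-- The pair solves a linear system whose coefficients have poles only at `0` and `1`. A common zero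
elsewhere would make the first function vanish near `w`, hence on the whole cut plane, against its
value `1` at the origin. -/
theorem hypF_no_common_zero {c : ℂ} (hc : ∀ n : ℕ, c ≠ -n) (a b : ℂ) {w : ℂ}
    (hw : w ∈ slitDomain) (hw0 : w ≠ 0) (h1 : hypF a b c w = 0)
    (h2 : hypF (a + 1) b (c + 1) w = 0) : False := by
  have hc1 : ∀ n : ℕ, c + 1 ≠ -n := by simpa using shift_ne_neg_natCast hc 1
  have hc0 : c ≠ 0 := by simpa using hc 0
  have hw1 : (1 - w) ≠ 0 := sub_ne_zero.2 (ne_one_of_mem_slitDomain hw).symm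
  have hnear : ∀ᶠ v in 𝓝 w, v ∈ slitDomain ∧ v ≠ 0 :=
    Filter.Eventually.and (isOpen_slitDomain.mem_nhds hw) (isOpen_ne.mem_nhds hw0)
  have hev := eventually_eq_zero_of_linear_system (hypF_analytic hc a b w hw)
    (hypF_analytic hc1 (a + 1) b w hw)
    (p := fun v => a / (1 - v)) (q := fun v => -(a * ((c - b) / c)) / (1 - v))
    (r := fun v => c / (v * (1 - v))) (s := fun v => -c / v - (c - b) / (1 - v))
    (by fun_prop (disch := assumption)) (by fun_prop (disch := assumption))
    (by fun_prop (disch := simp_all)) (by fun_prop (disch := assumption))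
    ?_ ?_ h1 h2
  · have := (hypF_analytic hc a b).eqOn_of_preconnected_of_eventuallyEq
      (g := fun _ => 0) analyticOnNhd_const isPreconnected_slitDomain hw hev
      zero_mem_slitDomain
    rw [hypF_zero hc] at this
    exact one_ne_zero this
  · filter_upwards [hnear] with v hv
    have hv1 : (1 - v) ≠ 0 := sub_ne_zero.2 (ne_one_of_mem_slitDomain hv.1).symm
    have hv0 := hv.2
    have e1 := hypF_raise_left hc a b hv.1
    have e3 := hypF_one_sub_mul hc a b hv.1
    simp only [Pi.add_apply, Pi.mul_apply]
    field_simp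
    field_simp at e3
    apply mul_left_cancel₀ hv0
    linear_combination (1 - v) * c * e1 + a * e3
  · filter_upwards [hnear] with v hv
    have hv1 : (1 - v) ≠ 0 := sub_ne_zero.2 (ne_one_of_mem_slitDomain hv.1).symm
    have hv0 := hv.2
    have e2 := hypF_lower_right hc (a + 1) b hv.1
    have e3 := hypF_one_sub_mul hc a b hv.1
    simp only [Pi.add_apply, Pi.mul_apply]
    field_simp
    field_simp at e3
    linear_combination (1 - v) * e2 + e3

end HypJacobi

namespace HypJacobi

open Complex Set Filter Topology
open scoped ENNReal

/-! ### Trace class operators -/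

section TraceClass

variable {H : Type*} [NormedAddCommGroup H] [InnerProductSpace ℂ H]

theorem hasSum_norm_inner_sq {ι : Type*} (v : HilbertBasis ι ℂ H) (x : H) :
    HasSum (fun i => ‖inner ℂ (v i) x‖ ^ 2) (‖x‖ ^ 2) := by
  have h := Complex.hasSum_re (v.hasSum_inner_mul_inner x x)
  rw [inner_self_eq_norm_sq_to_K] at h
  convert! h using 1
  · funext i
    rw [← inner_conj_symm x, ← normSq_eq_conj_mul_self, normSq_eq_norm_sq, ofReal_re]
  · norm_cast

theorem norm_cfcAbs_apply [CompleteSpace H] (T : H →L[ℂ] H) (x : H) : ‖CFC.abs T x‖ = ‖T x‖ := by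
  have hA : star (CFC.abs T) = CFC.abs T := (CFC.abs_nonneg T).isSelfAdjoint
  have h : inner ℂ (CFC.abs T x) (CFC.abs T x) = inner ℂ (T x) (T x) := by
    rw [← ContinuousLinearMap.adjoint_inner_right, ← ContinuousLinearMap.star_eq_adjoint, hA,
      ← mul_apply_eq_comp, CFC.abs_mul_abs, mul_apply_eq_comp,
      ContinuousLinearMap.star_eq_adjoint, ContinuousLinearMap.adjoint_inner_right]
  rw [inner_self_eq_norm_sq_to_K, inner_self_eq_norm_sq_to_K] at h
  have h' : ‖CFC.abs T x‖ ^ 2 = ‖T x‖ ^ 2 := by exact_mod_cast h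
  exact (sq_eq_sq₀ (norm_nonneg _) (norm_nonneg _)).1 h'

theorem re_inner_eq_norm_sqrt_sq [CompleteSpace H] {A : H →L[ℂ] H} (hA : 0 ≤ A) (x : H) :
    (inner ℂ x (A x)).re = ‖CFC.sqrt A x‖ ^ 2 := by
  have hS : star (CFC.sqrt A) = CFC.sqrt A := (CFC.sqrt_nonneg A).isSelfAdjoint
  have h : inner ℂ x (A x) = inner ℂ (CFC.sqrt A x) (CFC.sqrt A x) := by
    rw [← ContinuousLinearMap.adjoint_inner_right, ← ContinuousLinearMap.star_eq_adjoint, hS,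
      ← mul_apply_eq_comp, CFC.sqrt_mul_sqrt_self A hA]
  rw [h, inner_self_eq_norm_sq_to_K]
  norm_cast

/-- With `S = |T|^{1/2}`, the trace in the basis `v` is the double sum of `|⟨eₖ, S vᵢ⟩|²`. Summed
over `i` first, it equals `∑ₖ ⟨eₖ, |T| eₖ⟩`, which is at most `∑ₖ ‖|T| eₖ‖ = ∑ₖ ‖T eₖ‖`. -/
theorem isTraceClass_of_summable_norm [CompleteSpace H] {κ : Type*} (e : HilbertBasis κ ℂ H)
    (T : H →L[ℂ] H) (hT : Summable fun k => ‖T (e k)‖) : IsTraceClass T := by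
  intro ι v
  set A := CFC.abs T
  have hA : 0 ≤ A := CFC.abs_nonneg T
  set S := CFC.sqrt A
  have hS : star S = S := (CFC.sqrt_nonneg A).isSelfAdjoint
  have hsymm : ∀ k i, ‖inner ℂ (e k) (S (v i))‖ = ‖inner ℂ (v i) (S (e k))‖ := by
    intro k i
    rw [← ContinuousLinearMap.adjoint_inner_left, ← ContinuousLinearMap.star_eq_adjoint, hS,
      norm_inner_symm]
  have h1 : Summable fun p : κ × ι => ‖inner ℂ (e p.1) (S (v p.2))‖ ^ 2 := by
    rw [summable_prod_of_nonneg fun p => by positivity]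
    constructor
    · intro k
      simp only [hsymm]
      exact (hasSum_norm_inner_sq v _).summable
    · refine Summable.of_nonneg_of_le (fun k => tsum_nonneg fun i => by positivity) (fun k => ?_) hT
      simp only [hsymm]
      rw [(hasSum_norm_inner_sq v _).tsum_eq, ← re_inner_eq_norm_sqrt_sq hA, ← norm_cfcAbs_apply]
      refine (Complex.re_le_norm _).trans ((norm_inner_le_norm _ _).trans ?_)
      rw [e.orthonormal.norm_eq_one, one_mul]
  have h2 := (summable_prod_of_nonneg fun p => by positivity).1 h1.prod_symm |>.2
  refine h2.congr fun i => ?_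
  rw [re_inner_eq_norm_sqrt_sq hA]
  exact (hasSum_norm_inner_sq e (S (v i))).tsum_eq

end TraceClass

/-! ### Tridiagonal operators on `ℓ²` -/

/-- The standard basis vectors of `ℓ²`. -/
noncomputable def stdVec (k : ℕ) : EllTwo := lp.single 2 k 1

theorem stdVec_apply (k i : ℕ) : stdVec k i = if i = k then 1 else 0 := by
  simp [stdVec, Pi.single_apply]

theorem norm_stdVec (k : ℕ) : ‖stdVec k‖ = 1 := by
  rw [stdVec, lp.norm_single (by norm_num)]
  simp

theorem inner_stdVec (k : ℕ) (x : EllTwo) : inner ℂ (stdVec k) x = x k := by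
  rw [stdVec, lp.inner_single_left]
  simp

theorem lp_single_eq_smul (k : ℕ) (t : ℂ) : (lp.single 2 k t : EllTwo) = t • stdVec k := by
  rw [stdVec, ← lp.single_smul]
  simp

/-- The standard Hilbert basis of `ℓ²`. -/
noncomputable def stdBasis : HilbertBasis ℕ ℂ EllTwo :=
  HilbertBasis.ofRepr (LinearIsometryEquiv.refl ℂ EllTwo)

theorem stdBasis_apply (k : ℕ) : stdBasis k = stdVec k := by
  rw [stdVec, ← stdBasis.repr_symm_single]
  rfl

/-- Expand `x = ∑ xₖ eₖ` and use `|xₖ| ≤ ‖x‖`. The bound is crude, but it suffices for perturbations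
with summable entries. -/
theorem norm_le_tsum_norm_stdVec {T : EllTwo →L[ℂ] EllTwo} (hT : Summable fun k => ‖T (stdVec k)‖) :
    ‖T‖ ≤ ∑' k, ‖T (stdVec k)‖ := by
  refine T.opNorm_le_bound (tsum_nonneg fun k => norm_nonneg _) fun x => ?_
  have hx := (lp.hasSum_single (p := 2) (by norm_num) x).mapL T
  simp only [lp_single_eq_smul, map_smul] at hx
  have hle : ∀ k, ‖x k • T (stdVec k)‖ ≤ ‖T (stdVec k)‖ * ‖x‖ := by
    intro k
    rw [norm_smul, mul_comm]
    exact mul_le_mul_of_nonneg_left (lp.norm_apply_le_norm (by norm_num) x k) (norm_nonneg _)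
  rw [← hx.tsum_eq, ← tsum_mul_right]
  exact tsum_of_norm_bounded (hT.mul_right _).hasSum hle

theorem IsMatrixOperator.sub {M M' : Matrix ℕ ℕ ℂ} {S T : EllTwo →L[ℂ] EllTwo}
    (hS : IsMatrixOperator M S) (hT : IsMatrixOperator M' T) :
    IsMatrixOperator (M - M') (S - T) := by
  intro x i
  simpa [sub_mul] using (hS x i).sub (hT x i)

theorem jacobiMatrix_sub (α β α' β' : ℕ → ℂ) :
    jacobiMatrix α β - jacobiMatrix α' β' = jacobiMatrix (α - α') (β - β') := by
  ext i j
  simp only [Matrix.sub_apply, jacobiMatrix, Pi.sub_apply]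
  split_ifs <;> simp

/-! ### Rows, columns and norm bounds of Jacobi operators -/

section Jacobi

variable {α β : ℕ → ℂ} {T : EllTwo →L[ℂ] EllTwo}

theorem jacobi_apply_zero (hT : IsMatrixOperator (jacobiMatrix α β) T) (x : EllTwo) :
    (T x) 0 = α 0 * x 0 + β 0 * x 1 := by
  refine (hT x 0).unique ?_
  convert! hasSum_sum_of_ne_finset_zero (L := SummationFilter.unconditional ℕ) (s := {0, 1}) fun j hj => ?_
  · simp [jacobiMatrix]
  · simp only [Finset.mem_insert, Finset.mem_singleton, not_or] at hj
    simp only [jacobiMatrix]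
    rw [if_neg (by omega), if_neg (by omega), if_neg (by omega), zero_mul]

theorem jacobi_apply_succ (hT : IsMatrixOperator (jacobiMatrix α β) T) (x : EllTwo) (i : ℕ) :
    (T x) (i + 1) = β i * x i + α (i + 1) * x (i + 1) + β (i + 1) * x (i + 2) := by
  refine (hT x (i + 1)).unique ?_
  convert! hasSum_sum_of_ne_finset_zero (L := SummationFilter.unconditional ℕ) (s := {i, i + 1, i + 2}) fun j hj => ?_
  · rw [Finset.sum_insert (by simp), Finset.sum_insert (by simp), Finset.sum_singleton]
    simp [jacobiMatrix, add_assoc]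
  · simp only [Finset.mem_insert, Finset.mem_singleton, not_or] at hj
    simp only [jacobiMatrix]
    rw [if_neg (by omega), if_neg (by omega), if_neg (by omega), zero_mul]

theorem jacobi_stdVec_zero (hT : IsMatrixOperator (jacobiMatrix α β) T) :
    T (stdVec 0) = α 0 • stdVec 0 + β 0 • stdVec 1 := by
  ext i
  rcases i with _ | i
  · simp only [jacobi_apply_zero hT, stdVec_apply, lp.coeFn_add, lp.coeFn_smul, Pi.add_apply,
      Pi.smul_apply, smul_eq_mul]
    simp
  · simp only [jacobi_apply_succ hT, stdVec_apply, lp.coeFn_add, lp.coeFn_smul, Pi.add_apply,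
      Pi.smul_apply, smul_eq_mul]
    rcases i with _ | i <;> simp

theorem jacobi_stdVec_succ (hT : IsMatrixOperator (jacobiMatrix α β) T) (k : ℕ) :
    T (stdVec (k + 1)) =
      β k • stdVec k + α (k + 1) • stdVec (k + 1) + β (k + 1) • stdVec (k + 2) := by
  ext i
  rcases i with _ | i
  · simp only [jacobi_apply_zero hT, stdVec_apply, lp.coeFn_add, lp.coeFn_smul, Pi.add_apply,
      Pi.smul_apply, smul_eq_mul]
    rcases k with _ | k <;> simp +arith
  · simp only [jacobi_apply_succ hT, stdVec_apply, lp.coeFn_add, lp.coeFn_smul, Pi.add_apply,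
      Pi.smul_apply, smul_eq_mul]
    by_cases h1 : i = k
    · subst h1; simp
    by_cases h2 : i = k + 1
    · subst h2; simp [show k + 1 + 1 ≠ k by omega]
    by_cases h3 : i + 1 = k
    · subst h3; simp +arith
    simp [h1, h2, h3, show i + 2 ≠ k + 1 by omega]

theorem norm_jacobi_stdVec_succ_le (hT : IsMatrixOperator (jacobiMatrix α β) T) (k : ℕ) :
    ‖T (stdVec (k + 1))‖ ≤ ‖β k‖ + ‖α (k + 1)‖ + ‖β (k + 1)‖ := by
  rw [jacobi_stdVec_succ hT]
  refine (norm_add₃_le).trans ?_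
  simp [norm_smul, norm_stdVec]

theorem norm_jacobi_stdVec_zero_le (hT : IsMatrixOperator (jacobiMatrix α β) T) :
    ‖T (stdVec 0)‖ ≤ ‖α 0‖ + ‖β 0‖ := by
  rw [jacobi_stdVec_zero hT]
  refine (norm_add_le _ _).trans ?_
  simp [norm_smul, norm_stdVec]

theorem summable_norm_jacobi_stdVec (hT : IsMatrixOperator (jacobiMatrix α β) T)
    (hα : Summable fun n => ‖α n‖) (hβ : Summable fun n => ‖β n‖) :
    Summable fun k => ‖T (stdVec k)‖ := by
  rw [← summable_nat_add_iff 1]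
  exact Summable.of_nonneg_of_le (fun _ => norm_nonneg _) (norm_jacobi_stdVec_succ_le hT)
    ((hβ.add ((summable_nat_add_iff 1).2 hα)).add ((summable_nat_add_iff 1).2 hβ))

theorem norm_jacobi_le (hT : IsMatrixOperator (jacobiMatrix α β) T)
    (hα : Summable fun n => ‖α n‖) (hβ : Summable fun n => ‖β n‖) :
    ‖T‖ ≤ ∑' n, ‖α n‖ + 2 * ∑' n, ‖β n‖ := by
  have h := summable_norm_jacobi_stdVec hT hα hβ
  have hα1 := (summable_nat_add_iff 1).2 hα
  have hβ1 := (summable_nat_add_iff 1).2 hβ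
  refine (norm_le_tsum_norm_stdVec h).trans ?_
  rw [h.tsum_eq_zero_add]
  have h1 : ∑' k, ‖T (stdVec (k + 1))‖ ≤
      ∑' k, ‖β k‖ + ∑' k, ‖α (k + 1)‖ + ∑' k, ‖β (k + 1)‖ := by
    rw [← hβ.tsum_add hα1, ← (hβ.add hα1).tsum_add hβ1]
    exact Summable.tsum_le_tsum (norm_jacobi_stdVec_succ_le hT) ((summable_nat_add_iff 1).2 h)
      ((hβ.add hα1).add hβ1)
  have h2 := norm_jacobi_stdVec_zero_le hT
  have h3 := hα.tsum_eq_zero_add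
  have h4 := hβ.tsum_eq_zero_add
  linarith

end Jacobi

/-! ### The free Jacobi matrix -/

theorem freeJacobi_isSelfAdjoint : IsSelfAdjoint freeJacobi := by
  rw [ContinuousLinearMap.isSelfAdjoint_iff']
  refine isMatrixOperator_unique (M := jacobiMatrix (fun _ => 0) (fun _ => 1)) (fun x i => ?_)
    isMatrixOperator_freeJacobi
  have h : (ContinuousLinearMap.adjoint freeJacobi x) i = (freeJacobi x) i := by
    rw [← inner_stdVec, ContinuousLinearMap.adjoint_inner_right]
    rcases i with _ | i
    · rw [jacobi_stdVec_zero isMatrixOperator_freeJacobi,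
        jacobi_apply_zero isMatrixOperator_freeJacobi]
      simp [inner_stdVec]
    · rw [jacobi_stdVec_succ isMatrixOperator_freeJacobi,
        jacobi_apply_succ isMatrixOperator_freeJacobi]
      simp [inner_stdVec, inner_add_left]
  rw [h]
  exact isMatrixOperator_freeJacobi x i

theorem hasSum_norm_sq (x : EllTwo) : HasSum (fun i => ‖x i‖ ^ 2) (‖x‖ ^ 2) := by
  have := hasSum_norm_inner_sq stdBasis x
  simpa only [stdBasis_apply, inner_stdVec] using this

theorem norm_freeJacobi_le : ‖freeJacobi‖ ≤ 2 := by
  refine ContinuousLinearMap.opNorm_le_bound _ (by norm_num) fun x => ?_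
  have h := hasSum_norm_sq (freeJacobi x)
  have hx := hasSum_norm_sq x
  -- The bound comes from `|xᵢ₋₁ + xᵢ₊₁|² ≤ 2|xᵢ₋₁|² + 2|xᵢ₊₁|²`; the inserted zero stands for the
  -- absent entry `x₋₁` in row `0`.
  have h0 : HasSum (fun i => (if i = 0 then 0 else ‖x (i - 1)‖ ^ 2)) (‖x‖ ^ 2) := by
    rw [← hasSum_nat_add_iff' 1]
    simpa using hx
  have h1 := (hasSum_nat_add_iff' 1).2 hx
  have hle := hasSum_le (fun i => ?_) h ((h0.mul_left 2).add (h1.mul_left 2))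
  · have hs : 0 ≤ ∑ i ∈ Finset.range 1, ‖x i‖ ^ 2 := Finset.sum_nonneg fun _ _ => by positivity
    exact le_of_sq_le_sq (by nlinarith) (by positivity)
  · rcases i with _ | i
    · rw [jacobi_apply_zero isMatrixOperator_freeJacobi]
      simp
      nlinarith [sq_nonneg ‖x 1‖]
    · rw [jacobi_apply_succ isMatrixOperator_freeJacobi]
      simp only [one_mul, zero_mul, add_zero, Nat.add_sub_cancel, i.succ_ne_zero, if_false]
      have := norm_add_le (x i) (x (i + 2))
      nlinarith [norm_nonneg (x i + x (i + 2)), sq_nonneg (‖x i‖ - ‖x (i + 2)‖)]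

theorem mem_resolventSet_freeJacobi {z : ℂ} (hz : z ∉ Complex.ofReal '' Icc (-2) 2) :
    z ∈ resolventSet ℂ freeJacobi := by
  by_contra h
  have hσ : z ∈ spectrum ℂ freeJacobi := h
  have h1 := freeJacobi_isSelfAdjoint.mem_spectrum_eq_re hσ
  have : Nontrivial EllTwo := ⟨stdVec 0, 0, fun h0 => by simpa [h0] using norm_stdVec 0⟩
  have h2 := spectrum.subset_closedBall_norm _ hσ
  rw [mem_closedBall_zero_iff] at h2
  have h3 := (abs_re_le_norm z).trans (h2.trans norm_freeJacobi_le)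
  exact hz ⟨z.re, abs_le.1 h3, h1.symm⟩

end HypJacobi

namespace HypJacobi

open Complex Set Filter Topology

/-! ### Asymptotics of the Jacobi coefficients -/

theorem dCoeff_odd (a b c : ℂ) (n : ℕ) : dCoeff a b c (2 * n + 1) =
    (a + n) * (c - b + n) / ((c + 2 * n) * (c + 2 * n + 1)) := by
  have h : ¬ Even (2 * n + 1) := by simp
  have h' : (2 * n + 1) / 2 = n := by omega
  simp only [dCoeff, cfCoeff, if_neg h, h', neg_neg]

theorem dCoeff_even (a b c : ℂ) (n : ℕ) : dCoeff a b c (2 * n + 2) =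
    (b + n + 1) * (c - a + n + 1) / ((c + 2 * n + 1) * (c + 2 * n + 2)) := by
  have h : Even (2 * n + 2) := ⟨n + 1, by ring⟩
  have h' : (2 * n + 2) / 2 = n + 1 := by omega
  simp only [dCoeff, cfCoeff, if_pos h, h', neg_neg]
  push_cast
  congr 1 <;> ring

/-- The diagonal coefficients `2 - 4d₂ₙ₊₁ - 4d₂ₙ₊₂`, without the exception at `n = 0`. -/
noncomputable def fullDiag (a b c : ℂ) (n : ℕ) : ℂ :=
  2 - 4 * dCoeff a b c (2 * n + 1) - 4 * dCoeff a b c (2 * n + 2)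

theorem jDiag_succ (a b c : ℂ) (n : ℕ) : jDiag a b c (n + 1) = fullDiag a b c (n + 1) := by
  simp [jDiag, fullDiag]

theorem add_two_mul_ne_zero {c : ℂ} (hc : ∀ n : ℕ, c ≠ -n) (n m : ℕ) : c + 2 * n + m ≠ 0 := by
  have := add_natCast_ne_zero hc (2 * n + m)
  push_cast at this
  rwa [add_assoc]

/-- Each `4dₘ` tends to `1`. In the combination the factor `c + 2n + 1` cancels and the numerator is
constant, so the entries are `O(n⁻²)`. -/
theorem fullDiag_eq {c : ℂ} (hc : ∀ n : ℕ, c ≠ -n) (a b : ℂ) (n : ℕ) :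
    fullDiag a b c n =
      2 * ((c - a - b) ^ 2 - (a - b) ^ 2) / ((c + 2 * n) * (c + 2 * n + 2)) := by
  have h0 : c + 2 * n ≠ 0 := by simpa using add_two_mul_ne_zero hc n 0
  have h1 : c + 2 * n + 1 ≠ 0 := by simpa using add_two_mul_ne_zero hc n 1
  have h2 : c + 2 * n + 2 ≠ 0 := by simpa using add_two_mul_ne_zero hc n 2
  rw [fullDiag, dCoeff_odd, dCoeff_even]
  field_simp
  ring

/-- With `s = c + 2n + 2`, `A = c - 2a`, `B = c - 2b`, the closed form reads `(s² - A²)(s² - B²) /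
(s²(s² - 1))`, the `16` absorbing four halves. The `s⁴` terms cancel, leaving `O(n⁻²)`. -/
theorem jOffSq_sub_one {c : ℂ} (hc : ∀ n : ℕ, c ≠ -n) (a b : ℂ) (n : ℕ) :
    jOffSq a b c n - 1 =
      (1 - (c - 2 * a) ^ 2 - (c - 2 * b) ^ 2 +
        (c - 2 * a) ^ 2 * (c - 2 * b) ^ 2 / (c + 2 * n + 2) ^ 2) /
        ((c + 2 * n + 1) * (c + 2 * n + 3)) := by
  have h1 : c + 2 * n + 1 ≠ 0 := by simpa using add_two_mul_ne_zero hc n 1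
  have h2 : c + 2 * n + 2 ≠ 0 := by simpa using add_two_mul_ne_zero hc n 2
  have h3 : c + 2 * n + 3 ≠ 0 := by simpa using add_two_mul_ne_zero hc n 3
  rw [jOffSq_eq, mul_div_assoc', div_sub_one (by simp [h1, h2, h3]), add_div', div_div, div_eq_div_iff]
  · ring
  all_goals simp [h1, h2, h3]

theorem le_norm_add_two_mul {c : ℂ} {n : ℕ} (hn : ‖c‖ ≤ n) (m : ℕ) : (n : ℝ) ≤ ‖c + 2 * n + m‖ := by
  have h : ‖(2 * n + m : ℂ)‖ = 2 * n + m := by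
    have : (2 * n + m : ℂ) = ((2 * n + m : ℕ) : ℂ) := by push_cast; ring
    rw [this, norm_natCast]
    push_cast
    ring
  have h1 := norm_sub_le (c + 2 * n + m) c
  rw [show c + 2 * n + m - c = 2 * n + m by ring, h] at h1
  have : (0 : ℝ) ≤ m := m.cast_nonneg
  linarith

theorem summable_norm_of_le_div_sq {u : ℕ → ℂ} (C : ℝ)
    (h : ∀ᶠ n : ℕ in atTop, ‖u n‖ ≤ C / ((n : ℝ) * n)) : Summable fun n => ‖u n‖ := by
  have hs : Summable fun n : ℕ => C / ((n : ℝ) * n) := by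
    have := (Real.summable_one_div_nat_pow (p := 2)).2 one_lt_two
    refine (this.mul_left C).congr fun n => ?_
    rw [sq, mul_one_div]
  refine Summable.of_norm_bounded_eventually_nat hs ?_
  simpa using h

theorem summable_norm_fullDiag {c : ℂ} (hc : ∀ n : ℕ, c ≠ -n) (a b : ℂ) :
    Summable fun n => ‖fullDiag a b c n‖ := by
  obtain ⟨N, hN⟩ := exists_nat_ge ‖c‖
  refine summable_norm_of_le_div_sq ‖2 * ((c - a - b) ^ 2 - (a - b) ^ 2)‖ ?_
  filter_upwards [eventually_ge_atTop N, eventually_gt_atTop 0] with n hn hn0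
  have hn' : ‖c‖ ≤ n := hN.trans (by exact_mod_cast hn)
  have h0 : (0 : ℝ) < n := by exact_mod_cast hn0
  have h1 := le_norm_add_two_mul hn' 0
  have h2 := le_norm_add_two_mul hn' 2
  push_cast at h1 h2
  rw [add_zero] at h1
  rw [fullDiag_eq hc, norm_div, norm_mul (c + 2 * n)]
  gcongr

theorem summable_norm_jOffSq_sub_one {c : ℂ} (hc : ∀ n : ℕ, c ≠ -n) (a b : ℂ) :
    Summable fun n => ‖jOffSq a b c n - 1‖ := by
  obtain ⟨N, hN⟩ := exists_nat_ge ‖c‖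
  refine summable_norm_of_le_div_sq (‖1 - (c - 2 * a) ^ 2 - (c - 2 * b) ^ 2‖ +
    ‖(c - 2 * a) ^ 2 * (c - 2 * b) ^ 2‖) ?_
  filter_upwards [eventually_ge_atTop N, eventually_gt_atTop 0] with n hn hn0
  have hn' : ‖c‖ ≤ n := hN.trans (by exact_mod_cast hn)
  have h0 : (1 : ℝ) ≤ n := by exact_mod_cast hn0
  have h1 := le_norm_add_two_mul hn' 1
  have h2 := le_norm_add_two_mul hn' 2
  have h3 := le_norm_add_two_mul hn' 3
  push_cast at h1 h2 h3
  rw [jOffSq_sub_one hc, norm_div, norm_mul (c + 2 * n + 1)]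
  gcongr
  refine (norm_add_le _ _).trans ?_
  gcongr
  rw [norm_div]
  refine div_le_self (norm_nonneg _) ?_
  rw [norm_pow]
  exact one_le_pow₀ (h0.trans h2)

/-- Here the choice of the principal root enters: it keeps `x` away from `-1`, so that decay of `βₖ²
- 1` passes to `βₖ - 1`. -/
theorem norm_sub_one_le_of_re_nonneg {x : ℂ} (hx : 0 ≤ x.re) : ‖x - 1‖ ≤ ‖x ^ 2 - 1‖ := by
  have h : 1 ≤ ‖x + 1‖ := by
    refine le_trans ?_ (re_le_norm _)
    simpa using hx
  rw [show x ^ 2 - 1 = (x - 1) * (x + 1) by ring, norm_mul]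
  exact le_mul_of_one_le_right (norm_nonneg _) h

theorem summable_norm_offDiag_sub_one {c : ℂ} (hc : ∀ n : ℕ, c ≠ -n) (a b : ℂ) {β : ℕ → ℂ}
    (hβ : ∀ k, β k ^ 2 = jOffSq a b c k)
    (hβ_principal : ∀ᶠ k in atTop, β k = jOffSq a b c k ^ (1 / 2 : ℂ)) :
    Summable fun n => ‖β n - 1‖ := by
  refine Summable.of_norm_bounded_eventually_nat (summable_norm_jOffSq_sub_one hc a b) ?_
  filter_upwards [hβ_principal] with k hk
  rw [norm_norm, ← hβ k]
  apply norm_sub_one_le_of_re_nonneg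
  rw [hk, one_div, cpow_inv_two_re]
  positivity

/-! ### Summable perturbations of the free Jacobi matrix -/

theorem exists_norm_le_of_summable {u : ℕ → ℂ} (h : Summable fun n => ‖u n‖) :
    ∃ C, ∀ n, ‖u n‖ ≤ C :=
  ⟨_, fun n => h.le_tsum n fun _ _ => norm_nonneg _⟩

/-- A Jacobi matrix whose coefficients differ summably from those of the free one. -/
theorem isMatrixOperator_jacobi_of_summable {α β : ℕ → ℂ} (hα : Summable fun n => ‖α n‖)
    (hβ : Summable fun n => ‖β n - 1‖) :
    IsMatrixOperator (jacobiMatrix α β) (jacobiOperator α β) := by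
  obtain ⟨C, hC⟩ := exists_norm_le_of_summable hα
  obtain ⟨D, hD⟩ := exists_norm_le_of_summable hβ
  refine isMatrixOperator_jacobi α β (max C (D + 1)) (fun n => (hC n).trans (le_max_left _ _))
    fun n => le_trans ?_ (le_max_right _ _)
  have := norm_add_le (β n - 1) 1
  rw [sub_add_cancel, norm_one] at this
  linarith [hD n]

theorem isMatrixOperator_sub_freeJacobi {α β : ℕ → ℂ} (hα : Summable fun n => ‖α n‖)
    (hβ : Summable fun n => ‖β n - 1‖) :
    IsMatrixOperator (jacobiMatrix α (fun n => β n - 1)) (jacobiOperator α β - freeJacobi) := by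
  have := (isMatrixOperator_jacobi_of_summable hα hβ).sub isMatrixOperator_freeJacobi
  rw [jacobiMatrix_sub] at this
  convert this using 2 <;> funext n <;> simp

theorem isTraceClass_sub_freeJacobi {α β : ℕ → ℂ} (hα : Summable fun n => ‖α n‖)
    (hβ : Summable fun n => ‖β n - 1‖) : IsTraceClass (jacobiOperator α β - freeJacobi) := by
  refine isTraceClass_of_summable_norm stdBasis _ ?_
  simp only [stdBasis_apply]
  exact summable_norm_jacobi_stdVec (isMatrixOperator_sub_freeJacobi hα hβ) hα hβ

theorem tendsto_jacobiOperator_shift {α β : ℕ → ℂ} (hα : Summable fun n => ‖α n‖)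
    (hβ : Summable fun n => ‖β n - 1‖) :
    Tendsto (fun N => jacobiOperator (fun n => α (n + N)) (fun n => β (n + N))) atTop
      (𝓝 freeJacobi) := by
  rw [tendsto_iff_norm_sub_tendsto_zero]
  have h := (tendsto_sum_nat_add fun n => ‖α n‖).add
    ((tendsto_sum_nat_add fun n => ‖β n - 1‖).const_mul 2)
  rw [mul_zero, add_zero] at h
  refine squeeze_zero (fun _ => norm_nonneg _) (fun N => ?_) h
  have hα' := (summable_nat_add_iff N).2 hα
  have hβ' := (summable_nat_add_iff N).2 hβ
  exact norm_jacobi_le (isMatrixOperator_sub_freeJacobi hα' hβ') hα' hβ'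

/-! ### The essential spectrum -/

theorem exists_unimodular_root {z : ℝ} (hz : z ∈ Icc (-2 : ℝ) 2) :
    ∃ ζ : ℂ, ‖ζ‖ = 1 ∧ ζ ^ 2 + 1 = z * ζ := by
  set s := Real.sqrt (1 - (z / 2) ^ 2)
  have hs : s ^ 2 = 1 - (z / 2) ^ 2 := Real.sq_sqrt (by nlinarith [hz.1, hz.2])
  refine ⟨⟨z / 2, s⟩, ?_, ?_⟩
  · rw [← sq_eq_sq₀ (norm_nonneg _) zero_le_one, ← normSq_eq_norm_sq, normSq_apply]
    linear_combination hs
  · apply Complex.ext <;> simp [sq]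
    · linear_combination -hs
    · ring

/-- The sequence `ζᵏ` solves the free recurrence, so the interior cancels and only boundary terms
survive, however long the packet is. -/
theorem freeJacobi_sub_sum {ζ z : ℂ} (hζ : ζ ^ 2 + 1 = z * ζ) (M L : ℕ) :
    (freeJacobi - algebraMap ℂ _ z) (∑ k ∈ Finset.range L, ζ ^ (k + 1) • stdVec (M + k + 1)) =
      ζ • stdVec M - stdVec (M + 1) - ζ ^ (L + 1) • stdVec (M + L) +
        ζ ^ L • stdVec (M + L + 1) := by
  induction L with
  | zero => simp
  | succ L ih =>
    rw [Finset.sum_range_succ, map_add, ih, map_smul, sub_apply,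
      jacobi_stdVec_succ isMatrixOperator_freeJacobi, Algebra.algebraMap_eq_smul_one,
      smul_apply, one_apply_eq_self, ← add_assoc M L 1]
    have h : z * ζ ^ (L + 1) = ζ ^ (L + 2) + ζ ^ L := by linear_combination -ζ ^ L * hζ
    simp only [one_smul, zero_smul, add_zero, smul_sub, smul_add, smul_smul, mul_comm _ z, h,
      add_smul]
    module

theorem norm_sum_stdVec {ζ : ℂ} (hζ : ‖ζ‖ = 1) (M L : ℕ) :
    ‖∑ k ∈ Finset.range L, ζ ^ (k + 1) • stdVec (M + k + 1)‖ ^ 2 = L := by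
  have ho : Orthonormal ℂ fun k => stdVec (M + k + 1) := by
    have := stdBasis.orthonormal.comp (fun k => M + k + 1) fun i j h => by simpa using h
    refine (congrArg (fun F => Orthonormal ℂ F) (funext fun k => ?_)).mp this
    exact stdBasis_apply _
  have h := ho.inner_sum (fun k => ζ ^ (k + 1)) (fun k => ζ ^ (k + 1)) (Finset.range L)
  rw [inner_self_eq_norm_sq_to_K] at h
  have h1 : ∀ k : ℕ, (starRingEnd ℂ) (ζ ^ (k + 1)) * ζ ^ (k + 1) = 1 := by
    intro k
    rw [← normSq_eq_conj_mul_self, normSq_eq_norm_sq]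
    simp [hζ]
  simp only [h1, Finset.sum_const, Finset.card_range, nsmul_eq_mul, mul_one] at h
  exact ofReal_injective (by simpa using h)

/-- A summable perturbation of the free Jacobi matrix has `[-2, 2]` in its spectrum. -/
theorem notMem_of_mem_resolventSet {α β : ℕ → ℂ} (hα : Summable fun n => ‖α n‖)
    (hβ : Summable fun n => ‖β n - 1‖) {z : ℂ} (hz : z ∈ resolventSet ℂ (jacobiOperator α β)) :
    z ∉ Complex.ofReal '' Icc (-2) 2 := by
  rintro ⟨z, hz', rfl⟩
  obtain ⟨ζ, hζ1, hζ⟩ := exists_unimodular_root hz'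
  set J := jacobiOperator α β
  have hK := summable_norm_jacobi_stdVec (isMatrixOperator_sub_freeJacobi hα hβ) hα hβ
  -- The packet starts beyond `M`, where the perturbation contributes less than `1`.
  obtain ⟨M, hM⟩ := ((tendsto_sum_nat_add fun k => ‖(J - freeJacobi) (stdVec k)‖).eventually
    (gt_mem_nhds one_pos)).exists
  obtain ⟨R, hR⟩ := (IsUnit.sub_iff.1 hz).exists_left_inv
  -- The packet has squared norm `L`, while `J - z` maps it to norm at most `5 = 4 + 1`: four
  -- boundary terms plus the perturbation. This `L` contradicts the bounded left inverse `R`.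
  obtain ⟨L, hL⟩ := exists_nat_gt ((‖R‖ * 5) ^ 2)
  set x := ∑ k ∈ Finset.range L, ζ ^ (k + 1) • stdVec (M + k + 1)
  have hx : ‖x‖ ^ 2 = L := norm_sum_stdVec hζ1 M L
  have h1 : ‖(freeJacobi - algebraMap ℂ _ (z : ℂ)) x‖ ≤ 4 := by
    rw [freeJacobi_sub_sum hζ]
    refine (norm_add_le _ _).trans ?_
    have h2 := norm_sub_le (ζ • stdVec M - stdVec (M + 1)) (ζ ^ (L + 1) • stdVec (M + L))
    have h3 := norm_sub_le (ζ • stdVec M) (stdVec (M + 1))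
    simp only [norm_smul, norm_pow, hζ1, norm_stdVec, one_pow, mul_one] at h2 h3 ⊢
    linarith
  have h2 : ‖(J - freeJacobi) x‖ ≤ 1 := by
    rw [map_sum]
    refine (norm_sum_le _ _).trans ?_
    simp only [map_smul, norm_smul, norm_pow, hζ1, one_pow, one_mul]
    refine le_trans ?_ hM.le
    have hs := (summable_nat_add_iff M).2 hK
    rw [hs.tsum_eq_zero_add]
    have hs1 := (summable_nat_add_iff 1).2 hs
    have := hs1.sum_le_tsum (Finset.range L) fun _ _ => norm_nonneg _
    refine le_trans (le_of_eq ?_) (this.trans (le_add_of_nonneg_left (norm_nonneg _)))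
    refine Finset.sum_congr rfl fun k _ => ?_
    rw [show k + 1 + M = M + k + 1 by ring]
  have h3 : (J - algebraMap ℂ _ (z : ℂ)) x =
      (freeJacobi - algebraMap ℂ _ (z : ℂ)) x + (J - freeJacobi) x := by
    simp only [sub_apply]
    abel
  have h4 : x = R ((J - algebraMap ℂ _ (z : ℂ)) x) := by
    rw [← mul_apply_eq_comp, hR, one_apply_eq_self]
  have h5 : ‖x‖ ≤ ‖R‖ * 5 := by
    calc ‖x‖ = ‖R ((J - algebraMap ℂ _ (z : ℂ)) x)‖ := congrArg _ h4
      _ ≤ ‖R‖ * ‖(J - algebraMap ℂ _ (z : ℂ)) x‖ := R.le_opNorm _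
      _ ≤ ‖R‖ * 5 := by
        gcongr
        rw [h3]
        refine (norm_add_le _ _).trans ?_
        linarith
  have h6 := pow_le_pow_left₀ (norm_nonneg _) h5 2
  rw [hx] at h6
  linarith

end HypJacobi

namespace HypJacobi

open Complex Set Filter Topology
open scoped ENNReal

/-! ### Hypergeometric solutions of the Jacobi recurrence -/

/-- `F(a + n, b + n, c + 2n; w)`. -/
noncomputable def evenF (a b c : ℂ) (n : ℕ) : ℂ → ℂ := hypF (a + n) (b + n) (c + 2 * n)

/-- `F(a + n, b + n + 1, c + 2n + 1; w)`. -/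
noncomputable def oddF (a b c : ℂ) (n : ℕ) : ℂ → ℂ := hypF (a + n) (b + n + 1) (c + 2 * n + 1)

section Recurrence

variable {c : ℂ} (hc : ∀ n : ℕ, c ≠ -n) (a b : ℂ)
include hc

theorem add_two_mul_ne_neg_natCast (n m : ℕ) : c + 2 * n ≠ -m := by
  have := shift_ne_neg_natCast hc (2 * n) m
  push_cast at this
  exact this

theorem add_two_mul_add_one_ne_neg_natCast (n m : ℕ) : c + 2 * n + 1 ≠ -m := by
  have := shift_ne_neg_natCast (add_two_mul_ne_neg_natCast hc n) 1 m
  push_cast at this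
  exact this

theorem evenF_analytic (n : ℕ) : AnalyticOnNhd ℂ (evenF a b c n) slitDomain :=
  hypF_analytic (add_two_mul_ne_neg_natCast hc n) _ _

theorem evenF_eq (n : ℕ) {w : ℂ} (hw : w ∈ slitDomain) :
    evenF a b c n w = oddF a b c n w - dCoeff a b c (2 * n + 1) * w * evenF a b c (n + 1) w := by
  have h := hypF_contiguous (add_two_mul_ne_neg_natCast hc n) (a + n) (b + n) hw
  rw [evenF, oddF, evenF, h, dCoeff_odd]
  push_cast
  rw [← add_assoc a, ← add_assoc b, show c + 2 * ((n : ℂ) + 1) = c + 2 * n + 2 by ring]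
  ring

/-- This is the contiguous relation with the first two parameters exchanged; the alternation
accounts for the two shapes of `dₘ`. -/
theorem oddF_eq (n : ℕ) {w : ℂ} (hw : w ∈ slitDomain) :
    oddF a b c n w =
      evenF a b c (n + 1) w - dCoeff a b c (2 * n + 2) * w * oddF a b c (n + 1) w := by
  have h := hypF_contiguous (add_two_mul_add_one_ne_neg_natCast hc n) (b + n + 1) (a + n) hw
  rw [oddF, evenF, oddF, hypF_comm, h, dCoeff_even]
  push_cast
  rw [hypF_comm, hypF_comm (b + n + 1 + 1), ← add_assoc a, ← add_assoc b,
    show c + 2 * ((n : ℂ) + 1) + 1 = c + 2 * n + 1 + 2 by ring,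
    show c + 2 * ((n : ℂ) + 1) = c + 2 * n + 1 + 1 by ring]
  ring

theorem evenF_three_term (n : ℕ) {w : ℂ} (hw : w ∈ slitDomain) :
    evenF a b c n w =
      (1 - (dCoeff a b c (2 * n + 1) + dCoeff a b c (2 * n + 2)) * w) * evenF a b c (n + 1) w -
        jOffSq a b c n / 16 * w ^ 2 * evenF a b c (n + 2) w := by
  have h1 := evenF_eq hc a b n hw
  have h2 := oddF_eq hc a b n hw
  have h3 := evenF_eq hc a b (n + 1) hw
  rw [show 2 * (n + 1) + 1 = 2 * n + 3 by ring] at h3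
  rw [jOffSq]
  linear_combination h1 + h2 + dCoeff a b c (2 * n + 2) * w * h3

end Recurrence

/-- The product `∏_{k < n} (-w βₖ / 4)`. -/
noncomputable def weight (β : ℕ → ℂ) (n : ℕ) (w : ℂ) : ℂ :=
  ∏ k ∈ Finset.range n, (-(w / 4) * β k)

theorem weight_succ (β : ℕ → ℂ) (n : ℕ) (w : ℂ) :
    weight β (n + 1) w = weight β n w * (-(w / 4) * β n) := Finset.prod_range_succ _ _

theorem weight_add (β : ℕ → ℂ) (N n : ℕ) (w : ℂ) :
    weight β (n + N) w = weight β N w * weight (fun k => β (k + N)) n w := by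
  rw [weight, weight, weight, add_comm n N, Finset.prod_range_add]
  simp only [add_comm N]

/-- The decaying solution of the recurrence of the Jacobi matrix with its first `N` rows and
columns removed. -/
noncomputable def tailSol (a b c : ℂ) (β : ℕ → ℂ) (N n : ℕ) (w : ℂ) : ℂ :=
  weight (fun k => β (k + N)) n w * evenF a b c (n + N + 1) w

section TailSol

variable {c : ℂ} (hc : ∀ n : ℕ, c ≠ -n) (a b : ℂ) {β : ℕ → ℂ}
  (hβ : ∀ k, β k ^ 2 = jOffSq a b c k) {z w : ℂ} (hw : w ∈ slitDomain) (hwz : w * (z - 2) = -4)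
include hc hβ hw hwz

/-- Row `0` lacks the neighbour of index `-1`. Up to the factor `-(z-2)`, the defect is the function
`evenF` at `N` which that neighbour would carry. -/
theorem tailSol_zero (N : ℕ) :
    (fullDiag a b c N - z) * tailSol a b c β N 0 w + β N * tailSol a b c β N 1 w =
      -(z - 2) * evenF a b c N w := by
  have h := evenF_three_term hc a b N hw
  have hb := hβ N
  simp only [tailSol, weight_succ, fullDiag, zero_add]
  rw [show 1 + N + 1 = N + 2 by ring, show weight (fun k => β (k + N)) 0 w = 1 from rfl]
  simp only [h]
  linear_combination (-(w / 4) * evenF a b c (N + 2) w) * hb +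
    ((dCoeff a b c (2 * N + 1) + dCoeff a b c (2 * N + 2)) * evenF a b c (N + 1) w +
      jOffSq a b c N / 16 * w * evenF a b c (N + 2) w) * (-hwz)

/-- Since `w(z-2) = -4`, the middle coefficient of the three-term recurrence is `(w/4)(aₙ - z)`, and
the factors `-wβₖ/4` symmetrize the outer ones. Only `βₖ²` is prescribed, so signs are immaterial
and zero values are allowed. -/
theorem tailSol_succ (N n : ℕ) :
    β (n + N) * tailSol a b c β N n w +
      (fullDiag a b c (n + 1 + N) - z) * tailSol a b c β N (n + 1) w +
      β (n + 1 + N) * tailSol a b c β N (n + 2) w = 0 := by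
  have h := evenF_three_term hc a b (n + 1 + N) hw
  have hb := hβ (n + 1 + N)
  have hw0 : w ≠ 0 := by
    rintro rfl
    norm_num at hwz
  simp only [tailSol, weight_succ, fullDiag]
  rw [show n + 2 + N + 1 = n + 1 + N + 2 by ring, show n + N + 1 = n + 1 + N by ring, h]
  apply mul_left_cancel₀ hw0
  linear_combination (weight (fun k => β (k + N)) n w * β (n + N)) *
    (w / 4 * (evenF a b c (n + 1 + N + 1) w) * hwz +
      w ^ 3 / 16 * evenF a b c (n + 1 + N + 2) w * hb)

end TailSol

theorem jacobi_sub_apply {α β : ℕ → ℂ} {T : EllTwo →L[ℂ] EllTwo}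
    (hT : IsMatrixOperator (jacobiMatrix α β) T) {z s : ℂ} {y : EllTwo}
    (h0 : (α 0 - z) * y 0 + β 0 * y 1 = s)
    (hs : ∀ n, β n * y n + (α (n + 1) - z) * y (n + 1) + β (n + 1) * y (n + 2) = 0) :
    (T - algebraMap ℂ _ z) y = s • stdVec 0 := by
  have hz : (T - algebraMap ℂ (EllTwo →L[ℂ] EllTwo) z) y = T y - z • y := by
    rw [sub_apply, Algebra.algebraMap_eq_smul_one, smul_apply, one_apply_eq_self]
  rw [hz]
  ext i
  rcases i with _ | i
  · simp only [lp.coeFn_sub, lp.coeFn_smul, Pi.sub_apply, Pi.smul_apply, smul_eq_mul,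
      jacobi_apply_zero hT, stdVec_apply, if_true, ← h0]
    ring
  · simp only [lp.coeFn_sub, lp.coeFn_smul, Pi.sub_apply, Pi.smul_apply, smul_eq_mul,
      jacobi_apply_succ hT, stdVec_apply, i.succ_ne_zero, if_false, mul_zero]
    linear_combination hs i

/-! ### Square summability near infinity -/

/-- Induction on `k`: the quotient of consecutive coefficients is at most `4(n+k+1)/(k+1)`, which is
the quotient of consecutive majorants. -/
theorem norm_gaussCoeff_le {a b c : ℂ} (hc : ∀ n : ℕ, c ≠ -n) {n : ℕ} (hn : 0 < n)
    (ha : ‖a‖ ≤ n) (hb : ‖b‖ ≤ n) (hcn : ‖c‖ ≤ n) (k : ℕ) :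
    ‖gaussCoeff (a + n) (b + n) (c + 2 * n) k‖ ≤ 4 ^ k * (n + k).choose k := by
  induction k with
  | zero => simp [gaussCoeff_zero]
  | succ k ih =>
    have hn' : (0 : ℝ) < n := by exact_mod_cast hn
    have hk : (0 : ℝ) ≤ k := k.cast_nonneg
    have h1 : ∀ x : ℂ, ‖x‖ ≤ n → ‖x + n + k‖ ≤ 2 * (n + k) := by
      intro x hx
      have := norm_add₃_le (a := x) (b := (n : ℂ)) (c := (k : ℂ))
      rw [norm_natCast, norm_natCast] at this
      linarith
    have h2 : (n + k : ℝ) ≤ ‖c + 2 * n + k‖ := by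
      have h := norm_sub_le (c + 2 * n + k) c
      have h' : ‖(2 * n + k : ℂ)‖ = 2 * n + k := by
        rw [show (2 * n + k : ℂ) = ((2 * n + k : ℕ) : ℂ) by push_cast; ring, norm_natCast]
        push_cast
        ring
      rw [show c + 2 * n + k - c = 2 * n + k by ring, h'] at h
      linarith
    have h3 : ‖(k : ℂ) + 1‖ = k + 1 := by exact_mod_cast norm_natCast (k + 1)
    have hch : ((n + k).choose k : ℝ) * (n + k + 1) = (n + (k + 1)).choose (k + 1) * (k + 1) := by
      have := Nat.add_one_mul_choose_eq (n + k) k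
      rw [mul_comm]
      exact_mod_cast this
    rw [gaussCoeff_succ (add_two_mul_ne_neg_natCast hc n), norm_mul, norm_div, norm_mul,
      norm_mul (c + 2 * n + k), h3]
    have h4 : ‖a + n + k‖ * ‖b + n + k‖ / (‖c + 2 * n + k‖ * (k + 1)) ≤
        4 * ((n + k + 1) / (k + 1)) := by
      calc ‖a + n + k‖ * ‖b + n + k‖ / (‖c + 2 * n + k‖ * (k + 1))
          ≤ (2 * (n + k)) * (2 * (n + k)) / ((n + k) * (k + 1)) := by
            gcongr
            · exact h1 a ha
            · exact h1 b hb
        _ = 4 * ((n + k) / (k + 1)) := by field_simp; ring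
        _ ≤ 4 * ((n + k + 1) / (k + 1)) := by
          refine mul_le_mul_of_nonneg_left ?_ (by norm_num)
          exact div_le_div_of_nonneg_right (by linarith) (by positivity)
    calc _ ≤ (4 ^ k * ((n + k).choose k : ℝ)) * (4 * ((n + k + 1) / (k + 1))) := by gcongr
      _ = 4 ^ (k + 1) * (((n + k).choose k * (n + k + 1)) / (k + 1)) := by ring
      _ = _ := by
        rw [hch]
        field_simp

/-- The binomial is at most `2^(n+k)`, and the radius `1/16` makes the ratio `4 · 2 · (1/16) = 1/2`.
-/
theorem norm_evenF_le {a b c : ℂ} (hc : ∀ n : ℕ, c ≠ -n) {n : ℕ} (hn : 0 < n)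
    (ha : ‖a‖ ≤ n) (hb : ‖b‖ ≤ n) (hcn : ‖c‖ ≤ n) {w : ℂ} (hw : ‖w‖ < 1 / 16) :
    ‖evenF a b c n w‖ ≤ 2 ^ (n + 1) := by
  have h := hypF_hasSum (add_two_mul_ne_neg_natCast hc n) (a + n) (b + n)
    (hw.trans (by norm_num : (1 : ℝ) / 16 < 1))
  have hg : HasSum (fun k : ℕ => (2 : ℝ) ^ n * (1 / 2) ^ k) (2 ^ (n + 1)) := by
    rw [pow_succ]
    exact hasSum_geometric_two.mul_left _
  rw [evenF, ← h.tsum_eq]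
  refine tsum_of_norm_bounded hg fun k => ?_
  rw [norm_mul, norm_pow]
  calc _ ≤ (4 ^ k * ((n + k).choose k : ℝ)) * (1 / 16) ^ k := by
        gcongr
        exact norm_gaussCoeff_le hc hn ha hb hcn k
    _ ≤ (4 ^ k * (2 ^ (n + k) : ℝ)) * (1 / 16) ^ k := by
        gcongr
        exact_mod_cast Nat.choose_le_two_pow _ _
    _ = 2 ^ n * (1 / 2) ^ k := by
        rw [pow_add, show (1 / 2 : ℝ) = 4 * 2 * (1 / 16) by norm_num, mul_pow, mul_pow]
        ring

theorem norm_weight_le {β : ℕ → ℂ} (hβ : ∀ k, ‖β k‖ ≤ 2) {w : ℂ} (hw : ‖w‖ < 1 / 16) (n : ℕ) :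
    ‖weight β n w‖ ≤ (1 / 32) ^ n := by
  induction n with
  | zero => simp [weight]
  | succ n ih =>
    rw [weight_succ, norm_mul, pow_succ, norm_mul, norm_neg, norm_div]
    have : ‖w‖ / ‖(4 : ℂ)‖ * ‖β n‖ ≤ 1 / 32 := by
      calc ‖w‖ / ‖(4 : ℂ)‖ * ‖β n‖ ≤ (1 / 16) / ‖(4 : ℂ)‖ * 2 := by
            gcongr
            exact hβ n
        _ = 1 / 32 := by norm_num
    gcongr

theorem memℓp_two_of_norm_le_geometric {u : ℕ → ℂ} {C r : ℝ} (hr0 : 0 ≤ r) (hr : r < 1)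
    (h : ∀ n, ‖u n‖ ≤ C * r ^ n) : Memℓp u 2 := by
  refine memℓp_gen ?_
  have hs : Summable fun n : ℕ => C ^ 2 * (r ^ 2) ^ n :=
    (summable_geometric_of_lt_one (by positivity) (by nlinarith)).mul_left _
  refine Summable.of_nonneg_of_le (fun n => by positivity) (fun n => ?_) hs
  rw [show (2 : ℝ≥0∞).toReal = ((2 : ℕ) : ℝ) by norm_num, Real.rpow_natCast, ← pow_mul, mul_comm 2,
    pow_mul, ← mul_pow]
  exact pow_le_pow_left₀ (norm_nonneg _) (h n) 2

/-- The weights decay like `32⁻ⁿ` and beat the growth `2ⁿ` of the hypergeometric factor, leaving the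
ratio `1/16`. -/
theorem memℓp_tailSol_of_norm_lt {a b c : ℂ} (hc : ∀ n : ℕ, c ≠ -n) {β : ℕ → ℂ} {N : ℕ}
    (ha : ‖a‖ ≤ N) (hb : ‖b‖ ≤ N) (hcn : ‖c‖ ≤ N) (hβ : ∀ k, ‖β (k + N)‖ ≤ 2) {w : ℂ}
    (hw : ‖w‖ < 1 / 16) : Memℓp (fun n => tailSol a b c β N n w) 2 := by
  refine memℓp_two_of_norm_le_geometric (C := 2 ^ (N + 2)) (r := 1 / 16) (by norm_num)
    (by norm_num) fun n => ?_
  have hN : (N : ℝ) ≤ (n + N + 1 : ℕ) := by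
    exact_mod_cast (by omega : N ≤ n + N + 1)
  rw [tailSol, norm_mul]
  calc _ ≤ (1 / 32 : ℝ) ^ n * 2 ^ (n + N + 1 + 1) := by
        gcongr
        · exact norm_weight_le hβ hw n
        · exact norm_evenF_le hc (by omega) (ha.trans hN) (hb.trans hN) (hcn.trans hN) hw
    _ = 2 ^ (N + 2) * (1 / 16) ^ n := by
        rw [show (1 / 16 : ℝ) = 1 / 32 * 2 by norm_num, mul_pow]
        ring

end HypJacobi

namespace HypJacobi

open Complex Set Filter Topology
open scoped ENNReal

/-! ### Square summability off `[-2, 2]` by analytic continuation -/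

/-- The substitution `w = -4 / (z - 2)`. -/
noncomputable def cutMap (z : ℂ) : ℂ := -4 / (z - 2)

theorem ne_two_of_notMem {z : ℂ} (hz : z ∉ Complex.ofReal '' Icc (-2) 2) : z ≠ 2 := by
  rintro rfl
  exact hz ⟨2, by norm_num, by simp⟩

theorem cutMap_mul {z : ℂ} (hz : z ≠ 2) : cutMap z * (z - 2) = -4 :=
  div_mul_cancel₀ _ (sub_ne_zero.2 hz)

theorem cutMap_ne_zero {z : ℂ} (hz : z ≠ 2) : cutMap z ≠ 0 :=
  div_ne_zero (by norm_num) (sub_ne_zero.2 hz)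

theorem cutMap_mem_slitDomain {z : ℂ} (hz : z ∉ Complex.ofReal '' Icc (-2) 2) :
    cutMap z ∈ slitDomain := by
  rintro ⟨x, hx, h⟩
  have hx1 : (1 : ℝ) ≤ x := hx
  have hx0 : (x : ℂ) ≠ 0 := by exact_mod_cast (zero_lt_one.trans_le hx1).ne'
  have h1 := cutMap_mul (ne_two_of_notMem hz)
  rw [← h] at h1
  refine hz ⟨2 - 4 / x, ⟨?_, ?_⟩, ?_⟩
  · have : 4 / x ≤ 4 := div_le_self (by norm_num) hx1
    linarith
  · have : 0 ≤ 4 / x := by positivity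
    linarith
  · push_cast
    field_simp
    linear_combination -h1

theorem cutMap_analyticAt {z : ℂ} (hz : z ≠ 2) : AnalyticAt ℂ cutMap z := by
  have := sub_ne_zero.2 hz
  unfold cutMap
  fun_prop (disch := assumption)

/-- If the pushed-out point were in `[-2,2]`, then `z` would lie between it and `2`. Along this ray
`cutMap` is divided by `t`, so small `w` can be reached. -/
theorem ray_notMem {z : ℂ} (hz : z ∉ Complex.ofReal '' Icc (-2) 2) {t : ℝ} (ht : 1 ≤ t) :
    2 + (t : ℂ) * (z - 2) ∉ Complex.ofReal '' Icc (-2) 2 := by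
  rintro ⟨x, hx, h⟩
  have ht0 : 0 < t := zero_lt_one.trans_le ht
  have htc : (t : ℂ) ≠ 0 := by exact_mod_cast ht0.ne'
  refine hz ⟨2 + (x - 2) / t, ⟨?_, ?_⟩, ?_⟩
  · have : (2 - x) / t ≤ 4 :=
      (div_le_self (by linarith [hx.2]) ht).trans (by linarith [hx.1])
    rw [show (x - 2) / t = -((2 - x) / t) by ring]
    linarith
  · have : 0 ≤ (2 - x) / t := div_nonneg (by linarith [hx.2]) ht0.le
    rw [show (x - 2) / t = -((2 - x) / t) by ring]
    linarith
  · push_cast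
    rw [h]
    field_simp
    ring

theorem resolvent_apply_analyticAt {T : EllTwo →L[ℂ] EllTwo} {z : ℂ} (hz : z ∈ resolventSet ℂ T)
    (x : EllTwo) (n : ℕ) : AnalyticAt ℂ (fun y => (resolvent T y x) n) z := by
  have hd : DifferentiableOn ℂ (fun y => (resolvent T y x) n) (resolventSet ℂ T) := by
    intro y hy
    have h := (spectrum.hasDerivAt_resolvent_const_left hy).differentiableAt
    have h2 : DifferentiableAt ℂ (fun y => inner ℂ (stdVec n) (resolvent T y x)) y :=
      (innerSL ℂ (stdVec n)).differentiableAt.comp y (h.clm_apply (differentiableAt_const x))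
    simp only [inner_stdVec] at h2
    exact h2.differentiableWithinAt
  exact hd.analyticAt ((spectrum.isOpen_resolventSet T).mem_nhds hz)

/-- Invertibility of `y - S` is an open condition on the pair `(S, y)`; the tube lemma makes it
uniform over the compact set. -/
theorem eventually_subset_resolventSet {X : Type*} {l : Filter X} {S : X → EllTwo →L[ℂ] EllTwo}
    {T : EllTwo →L[ℂ] EllTwo} (hS : Tendsto S l (𝓝 T)) {K : Set ℂ} (hK : IsCompact K)
    (hKT : K ⊆ resolventSet ℂ T) : ∀ᶠ i in l, K ⊆ resolventSet ℂ (S i) := by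
  have hopen : IsOpen {p : (EllTwo →L[ℂ] EllTwo) × ℂ | IsUnit (algebraMap ℂ _ p.2 - p.1)} :=
    Units.isOpen.preimage (((algebraMapCLM ℂ (EllTwo →L[ℂ] EllTwo)).continuous.comp
      continuous_snd).sub continuous_fst)
  obtain ⟨U, V, hU, -, hTU, hKV, hUV⟩ := generalized_tube_lemma (isCompact_singleton (x := T)) hK
    hopen (by rintro ⟨S, y⟩ ⟨rfl, hy⟩; exact hKT hy)
  filter_upwards [hS.eventually (hU.mem_nhds (hTU rfl))] with i hi y hy
  exact hUV (show (S i, y) ∈ U ×ˢ V from ⟨hi, hKV hy⟩)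

/-! ### Continuation of square summability along a ray -/

section

variable {c : ℂ} (hc : ∀ n : ℕ, c ≠ -n) (a b : ℂ) {β : ℕ → ℂ}
  (hβ : ∀ k, β k ^ 2 = jOffSq a b c k) (hβs : Summable fun n => ‖β n - 1‖)
include hc hβ hβs

/-- A square-summable solution is determined by its defect in row `0`. The sign differs from
`tailSol_zero` because `resolvent` inverts `z - J`. -/
theorem tailSol_eq_resolvent {N : ℕ} {z : ℂ} (hz : z ≠ 2) (hw : cutMap z ∈ slitDomain)
    (hzρ : z ∈ resolventSet ℂ
      (jacobiOperator (fun n => fullDiag a b c (n + N)) (fun n => β (n + N))))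
    (hmem : Memℓp (fun n => tailSol a b c β N n (cutMap z)) 2) (n : ℕ) :
    tailSol a b c β N n (cutMap z) = (z - 2) * evenF a b c N (cutMap z) *
      (resolvent (jacobiOperator (fun n => fullDiag a b c (n + N)) (fun n => β (n + N))) z
        (stdVec 0)) n := by
  set J := jacobiOperator (fun n => fullDiag a b c (n + N)) (fun n => β (n + N))
  have hJ : IsMatrixOperator _ J := isMatrixOperator_jacobi_of_summable
    ((summable_nat_add_iff N).2 (summable_norm_fullDiag hc a b))
    ((summable_nat_add_iff N).2 hβs)
  set y : EllTwo := ⟨fun n => tailSol a b c β N n (cutMap z), hmem⟩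
  have hy : (J - algebraMap ℂ _ z) y = (-(z - 2) * evenF a b c N (cutMap z)) • stdVec 0 := by
    refine jacobi_sub_apply hJ ?_ fun n => tailSol_succ hc a b hβ hw (cutMap_mul hz) N n
    simpa using tailSol_zero hc a b hβ hw (cutMap_mul hz) N
  have hR : resolvent J z * (algebraMap ℂ _ z - J) = 1 := Ring.inverse_mul_cancel _ hzρ
  have h1 : y = ((z - 2) * evenF a b c N (cutMap z)) • resolvent J z (stdVec 0) := by
    calc y = (resolvent J z * (algebraMap ℂ _ z - J)) y := by rw [hR, one_apply_eq_self]
      _ = resolvent J z (-((J - algebraMap ℂ _ z) y)) := by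
        rw [mul_apply_eq_comp, ← neg_sub J, neg_apply]
      _ = _ := by
        rw [hy, ← neg_smul, map_smul]
        congr 1
        ring
  have h2 := congrArg (fun v : EllTwo => v n) h1
  simpa using h2

/-- Square summability is not itself an analytic condition, but each entrywise identity with the
resolvent vector is. That identity is known near the far end of the segment and is continued back to
`z`. -/
theorem exists_memℓp_tailSol {z : ℂ} (hz : z ∉ Complex.ofReal '' Icc (-2) 2) :
    ∃ N, Memℓp (fun n => tailSol a b c β N n (cutMap z)) 2 := by
  have hz2 := ne_two_of_notMem hz
  obtain ⟨T, hT1, hT⟩ : ∃ T : ℝ, 1 ≤ T ∧ ‖cutMap z‖ / T < 1 / 16 := by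
    refine ⟨16 * ‖cutMap z‖ + 1, by linarith [norm_nonneg (cutMap z)], ?_⟩
    rw [div_lt_iff₀ (by positivity)]
    linarith
  set ray : ℝ → ℂ := fun t => 2 + (t : ℂ) * (z - 2)
  set K : Set ℂ := ray '' Icc 1 T
  have hray : Continuous ray := by fun_prop
  have hKc : IsCompact K := isCompact_Icc.image hray
  have hKp : IsPreconnected K := isPreconnected_Icc.image _ hray.continuousOn
  have hKcut : ∀ y ∈ K, y ∉ Complex.ofReal '' Icc (-2) 2 := by
    rintro _ ⟨t, ht, rfl⟩
    exact ray_notMem hz ht.1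
  have hzK : z ∈ K := ⟨1, ⟨le_rfl, hT1⟩, by simp [ray]⟩
  have hTK : ray T ∈ K := ⟨T, ⟨hT1, le_rfl⟩, rfl⟩
  have hTw : ‖cutMap (ray T)‖ < 1 / 16 := by
    have : cutMap (ray T) = cutMap z / T := by
      simp only [cutMap, ray, add_sub_cancel_left]
      rw [div_div, mul_comm]
    rwa [this, norm_div, norm_real, Real.norm_of_nonneg (by linarith)]
  have hα := summable_norm_fullDiag hc a b
  have hev := eventually_subset_resolventSet (tendsto_jacobiOperator_shift hα hβs) hKc
    fun y hy => mem_resolventSet_freeJacobi (hKcut y hy)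
  have hβ2 : ∀ᶠ n in atTop, ‖β n‖ ≤ 2 := by
    filter_upwards [hβs.tendsto_atTop_zero.eventually (gt_mem_nhds one_pos)] with n hn
    have := norm_add_le (β n - 1) 1
    rw [sub_add_cancel, norm_one] at this
    linarith
  -- One `N` serves two purposes: the segment avoids the spectrum of the truncated operator, and the
  -- small-`w` bounds apply.
  obtain ⟨N, hNρ, hNβ, hNa, hNb, hNc⟩ := (hev.and ((eventually_forall_ge_atTop.2 hβ2).and
    ((tendsto_natCast_atTop_atTop.eventually_ge_atTop ‖a‖).and
      ((tendsto_natCast_atTop_atTop.eventually_ge_atTop ‖b‖).and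
        (tendsto_natCast_atTop_atTop.eventually_ge_atTop ‖c‖))))).exists
  refine ⟨N, ?_⟩
  set J := jacobiOperator (fun n => fullDiag a b c (n + N)) (fun n => β (n + N)) with hJ
  have hEan : ∀ m, ∀ y ∈ K, AnalyticAt ℂ (fun y => evenF a b c m (cutMap y)) y := fun m y hy =>
    (evenF_analytic hc a b m _ (cutMap_mem_slitDomain (hKcut y hy))).comp
      (cutMap_analyticAt (ne_two_of_notMem (hKcut y hy)))
  have key : ∀ n, tailSol a b c β N n (cutMap z) = (z - 2) * evenF a b c N (cutMap z) *
      (resolvent J z (stdVec 0)) n := by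
    intro n
    have hF : AnalyticOnNhd ℂ (fun y => tailSol a b c β N n (cutMap y)) K := by
      intro y hy
      refine AnalyticAt.mul ?_ (hEan _ y hy)
      have hcut := cutMap_analyticAt (ne_two_of_notMem (hKcut y hy))
      unfold weight
      fun_prop
    have hG : AnalyticOnNhd ℂ (fun y => (y - 2) * evenF a b c N (cutMap y) *
        (resolvent J y (stdVec 0)) n) K := by
      intro y hy
      exact ((analyticAt_id.sub analyticAt_const).mul (hEan _ y hy)).mul
        (resolvent_apply_analyticAt (hNρ hy) _ _)
    refine hF.eqOn_of_preconnected_of_eventuallyEq hG hKp hTK ?_ hzK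
    have hT2 := ne_two_of_notMem (hKcut _ hTK)
    filter_upwards [isOpen_ne.mem_nhds hT2,
      (cutMap_analyticAt hT2).continuousAt.norm.eventually (gt_mem_nhds hTw),
      (spectrum.isOpen_resolventSet J).mem_nhds (hNρ hTK)] with y hy2 hyw hyρ
    exact tailSol_eq_resolvent hc a b hβ hβs hy2
      (mem_slitDomain_of_norm_lt (hyw.trans (by norm_num))) hyρ
      (memℓp_tailSol_of_norm_lt hc hNa hNb hNc (fun k => hNβ _ (by omega)) hyw) n
  -- The resolvent side is an element of `ℓ²` by construction, so the entrywise identity transfers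
  -- membership.
  have hmem := lp.memℓp (((z - 2) * evenF a b c N (cutMap z)) • resolvent J z (stdVec 0))
  convert hmem using 1
  funext n
  rw [key n]
  simp

/-- Beyond index `N` the full solution is a constant multiple of the truncated one, and finitely
many entries do not matter. -/
theorem memℓp_tailSol_zero {z : ℂ} (hz : z ∉ Complex.ofReal '' Icc (-2) 2) :
    Memℓp (fun n => tailSol a b c β 0 n (cutMap z)) 2 := by
  obtain ⟨N, hN⟩ := exists_memℓp_tailSol hc a b hβ hβs hz
  have h : ∀ n, tailSol a b c β 0 (n + N) (cutMap z) =
      weight β N (cutMap z) * tailSol a b c β N n (cutMap z) := by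
    intro n
    simp only [tailSol, add_zero]
    rw [weight_add, mul_assoc]
  have hs := (hN.const_mul (weight β N (cutMap z))).summable (by norm_num)
  refine memℓp_gen ((summable_nat_add_iff N).1 ?_)
  simp only [h]
  exact hs

end

end HypJacobi

open HypJacobi

namespace HypJacobi

open Complex Set Filter Topology

/-! ### The `m`-function -/

section

variable {c : ℂ} (hc : ∀ n : ℕ, c ≠ -n) (a b : ℂ) {β : ℕ → ℂ}
  (hβ : ∀ k, β k ^ 2 = jOffSq a b c k) {z w : ℂ} (hw : w ∈ slitDomain) (hwz : w * (z - 2) = -4)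

include hc in
theorem summable_norm_jDiag : Summable fun n => ‖jDiag a b c n‖ := by
  rw [← summable_nat_add_iff 1]
  simp only [jDiag_succ]
  exact (summable_nat_add_iff 1).2 (summable_norm_fullDiag hc a b)

include hc hβ hw hwz in
-- The exceptional entry `a₀` omits `-4d₁`. By the contiguous relation this replaces `F(a,b,c)` by
-- `F(a,b+1,c+1)` in the defect of row `0`.
theorem jDiag_tailSol_zero :
    (jDiag a b c 0 - z) * tailSol a b c β 0 0 w + β 0 * tailSol a b c β 0 1 w =
      -(z - 2) * oddF a b c 0 w := by
  have h := tailSol_zero hc a b hβ hw hwz 0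
  have h1 := evenF_eq hc a b 0 hw
  have h2 : tailSol a b c β 0 0 w = evenF a b c 1 w := one_mul _
  rw [h2] at h ⊢
  simp only [jDiag, fullDiag, if_true, mul_zero, zero_add] at h h1 ⊢
  linear_combination h - (z - 2) * h1 + dCoeff a b c 1 * evenF a b c 1 w * hwz

include hc hβ in
theorem mFunction_eq (hβs : Summable fun n => ‖β n - 1‖) (hd : dCoeff a b c 1 ≠ 0)
    (hzρ : z ∈ resolventSet ℂ (jacobiOperator (jDiag a b c) β)) :
    z ∉ Complex.ofReal '' Icc (-2) 2 ∧ hypF a (b + 1) (c + 1) (-4 / (z - 2)) ≠ 0 ∧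
      bFun a b c z =
        inner ℂ e₀ (Ring.inverse (jacobiOperator (jDiag a b c) β - algebraMap ℂ _ z) e₀) := by
  have hα := summable_norm_jDiag hc a b
  have hz := notMem_of_mem_resolventSet hα hβs hzρ
  have hz2 := ne_two_of_notMem hz
  have hw := cutMap_mem_slitDomain hz
  have hwz := cutMap_mul hz2
  have hJ := isMatrixOperator_jacobi_of_summable hα hβs
  set J := jacobiOperator (jDiag a b c) β
  set y : EllTwo := ⟨fun n => tailSol a b c β 0 n (cutMap z),
    memℓp_tailSol_zero hc a b hβ hβs hz⟩
  have hy0 : y 0 = evenF a b c 1 (cutMap z) := one_mul _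
  have hy : (J - algebraMap ℂ _ z) y = (-(z - 2) * oddF a b c 0 (cutMap z)) • stdVec 0 := by
    refine jacobi_sub_apply hJ (jDiag_tailSol_zero hc a b hβ hw hwz) fun n => ?_
    rw [jDiag_succ]
    exact tailSol_succ hc a b hβ hw hwz 0 n
  have hinv : Ring.inverse (J - algebraMap ℂ _ z) * (J - algebraMap ℂ _ z) = 1 :=
    Ring.inverse_mul_cancel _ (IsUnit.sub_iff.1 hzρ)
  have hRy : y = (-(z - 2) * oddF a b c 0 (cutMap z)) •
      Ring.inverse (J - algebraMap ℂ _ z) (stdVec 0) := by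
    rw [← map_smul, ← hy, ← mul_apply_eq_comp, hinv, one_apply_eq_self]
  have hodd : oddF a b c 0 = hypF a (b + 1) (c + 1) := by simp [oddF]
  have heven : evenF a b c 1 = hypF (a + 1) (b + 1) (c + 2) := by simp [evenF]
  -- A vanishing denominator forces `y = 0`, hence `y₀ = F(a+1,b+1,c+2;w) = 0`, a forbidden common
  -- zero.
  have hne : hypF a (b + 1) (c + 1) (cutMap z) ≠ 0 := by
    intro h0
    rw [hodd, h0, mul_zero, zero_smul] at hRy
    rw [hRy, heven] at hy0
    have hc1 : ∀ n : ℕ, c + 1 ≠ -n := by simpa using shift_ne_neg_natCast hc 1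
    refine hypF_no_common_zero hc1 a (b + 1) hw (cutMap_ne_zero hz2) h0 ?_
    rw [show c + 1 + 1 = c + 2 by ring, ← hy0]
    rfl
  refine ⟨hz, hne, ?_⟩
  have h1 := evenF_eq hc a b 0 hw
  rw [show evenF a b c 0 = hypF a b c by simp [evenF], hodd, heven] at h1
  simp only [mul_zero, zero_add] at h1
  have h2 := congrArg (fun v : EllTwo => v 0) hRy
  simp only [lp.coeFn_smul, Pi.smul_apply, smul_eq_mul] at h2
  rw [hy0, heven, hodd] at h2
  -- After `h1` the factor `d₁` cancels and `B` becomes `(w/4) F(a+1,b+1,c+2;w) / F(a,b+1,c+1;w)`;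
  -- `h2` and `w(z-2) = -4` turn this into `m`.
  rw [show e₀ = stdVec 0 from rfl, inner_stdVec, bFun, ← cutMap, h1]
  set m := (Ring.inverse (J - algebraMap ℂ _ z) (stdVec 0)) 0
  rw [h2]
  field_simp
  linear_combination -(dCoeff a b c 1 * m) * hwz

end

end HypJacobi

theorem mainTheorem1 (a b c : ℂ) (hc : ∀ n : ℕ, c ≠ -(n : ℂ))
    (β : ℕ → ℂ) (hβ : ∀ k, β k ^ 2 = jOffSq a b c k)
    (hβ_principal : ∀ᶠ k in Filter.atTop, β k = jOffSq a b c k ^ (1 / 2 : ℂ)) :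
    -- the Jacobi matrix generates the bounded operator `J`
    IsMatrixOperator (jacobiMatrix (jDiag a b c) β) (jacobiOperator (jDiag a b c) β) ∧
    -- `B` is the m-function of `J` on the resolvent set, with every term of `B` well defined there
    (a ≠ 0 → c ≠ b → ∀ z ∈ resolventSet ℂ (jacobiOperator (jDiag a b c) β),
      z ∉ Complex.ofReal '' Set.Icc (-2) 2 ∧
      hypF a (b + 1) (c + 1) (-4 / (z - 2)) ≠ 0 ∧
      bFun a b c z =
        inner ℂ e₀ (Ring.inverse (jacobiOperator (jDiag a b c) β - algebraMap ℂ _ z) e₀)) ∧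
    -- `J - J₀` is trace class
    IsTraceClass (jacobiOperator (jDiag a b c) β - freeJacobi) := by
  have hα := summable_norm_jDiag hc a b
  have hβs := summable_norm_offDiag_sub_one hc a b hβ hβ_principal
  refine ⟨isMatrixOperator_jacobi_of_summable hα hβs, fun ha hcb z hz => ?_,
    isTraceClass_sub_freeJacobi hα hβs⟩
  refine mFunction_eq hc a b hβ hβs ?_ hz
  have h0 : c ≠ 0 := by simpa using hc 0
  have h1 : c + 1 ≠ 0 := by simpa using add_natCast_ne_zero hc 1
  have h := dCoeff_odd a b c 0
  simp only [Nat.cast_zero, mul_zero, zero_add, add_zero] at h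
  rw [h]
  exact div_ne_zero (mul_ne_zero ha (sub_ne_zero.2 hcb)) (mul_ne_zero h0 h1)
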